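/- **Idealised Control No-Go.** Let $\mathcal H_A,\mathcal H_G$ be finite-dimensional Hilbert spaces with self-adjoint Hamiltonians $\hat H_A,\hat H_G$, put $\hat H_{AG}=\hat H_A\otimes 1+1\otimes\hat H_G$ and let $\tau_G=e^{-\beta\hat H_G}/\mathrm{tr}\,e^{-\beta\hat H_G}$ be a Gibbs state, $\beta\in\mathbb R$. Let $\mathcal H_{Cl}$ be an arbitrary Hilbert space, $\rho^0_{Cl}$ a density operator on it, and $\hat H$ a time-independent (possibly unbounded) self-adjoint operator on $\mathcal H_A\otimes\mathcal H_G\otimes\mathcal H_{Cl}$. For an orthonormal basis $\{|E_l\rangle\}_{l=1}^{d_Ad_G}$ of $\mathcal H_A\otimes\mathcal H_G$ consisting of eigenvectors of $\hat H_{AG}$ write $$\hat H=\hat H_{AG}\otimes 1_{Cl}+\sum_{l,m}|E_l\rangle\langle E_m|\otimes\hat H^{(l,m)}_{Cl},$$ that is, $\hat H_{Cl}^{(l,m)}$ is the operator $\psi\mapsto(\langle E_l|\otimes 1)(\hat H-\hat H_{AG}\otimes 1)(|E_m\rangle\otimes\psi)$ with domain all $\psi$ for which $|E_m\rangle\otimes\psi$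 lies in the domain of $\hat H$. Let $0<t_1<t_2<t_3$. For a density operator $\rho^0_A$ on $\mathcal H_A$ put $\rho_A^0(t)=e^{-it\hat H_A}\rho_A^0e^{it\hat H_A}$. Consider the following assertions. 1. For all $k\ne l$ there is $r>t_2$ such that all the coefficients below exist and, for all real $|t|<r$, $$\mathrm{tr}\big[e^{-it\hat H_{Cl}^{(k,k)}}\rho^0_{Cl}\,e^{it\hat H_{Cl}^{(l,l)}}\big]=\sum_{N=0}^\infty\Big(\sum_{n+m=N}\mathrm{tr}\Big[\tfrac{(-i\hat H_{Cl}^{(k,k)})^n}{n!}\,\rho_{Cl}^0\,\tfrac{(i\hat H_{Cl}^{(l,l)})^m}{m!}\Big]\Big)t^{N}.$$ 2. ($U,\rho_A^0$) $U$ is a unitary on $\mathcal H_A\otimes\mathcal H_G$ with non-degenerate spectrum, with $[U,\hat H_{AG}]=0$ and $[U\otimes 1_{Cl},\hat H]=0$, the vectors $|E_l\rangle$ are eigenvectors of $U$ (which is automatic if $\hat H_{AG}$ has non-degenerate spectrum, and is otherwise a choice of the energy eigenbasis), and $$\mathrm{tr}_{G,Cl}\big[e^{-it\hat H}(\rho_A^0\otimes\tau_G\otimes\rho_{Cl}^0)e^{it\hat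 H}\big]=\begin{cases}\rho_A^0(t),&t\in[0,t_1],\\ \mathrm{tr}_G\big[U(\rho_A^0(t)\otimes\tau_G)U^\dagger\big],&t\in[t_2,t_3].\end{cases}$$ Then: (i) For every state $\rho_A^0$, assertion 1 cannot hold together with the assertion that there is a $U$ satisfying 2 for which the thermal operation acts non-trivially on the state, i.e. $\mathrm{tr}_G[U(\rho_A^0(t)\otimes\tau_G)U^\dagger]\neq\rho^0_A(t)$ for some $t\in[t_2,t_3]$. (ii) If $\dim\mathcal H_A\ge 2$, assertion 1 cannot hold together with the assertion that there is a single $U$ satisfying 2 for all states $\rho_A^0$. -/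

import Mathlib

open scoped Matrix Kronecker InnerProductSpace ComplexOrder

namespace IdealisedControl

noncomputable section

universe u

/-! ### Traces and states on a Hilbert space of arbitrary dimension -/

section OneSpace

variable {𝓗 : Type u} [NormedAddCommGroup 𝓗] [InnerProductSpace ℂ 𝓗]

/-- `tr X = c`: in every orthonormal basis the diagonal of the bounded operator `X` is
(unconditionally) summable with sum `c`. -/
def HasTrace (X : 𝓗 →L[ℂ] 𝓗) (c : ℂ) : Prop :=
  ∀ (κ : Type u) (b : HilbertBasis κ ℂ 𝓗), HasSum (fun j => ⟪b j, X (b j)⟫_ℂ) c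

variable [CompleteSpace 𝓗]

/-- A normalised quantum state: a positive operator of trace one. -/
structure IsDensityOperator (ρ : 𝓗 →L[ℂ] 𝓗) : Prop where
  positive : ρ.IsPositive
  trace_one : HasTrace ρ 1

/-! ### The unitary group `e^{-itK}` of a (possibly unbounded) self-adjoint operator -/

/-- `V` is a strongly continuous one-parameter unitary group whose generator is `K`, that is,
`V t = e^{-itK}`: a vector `ψ` lies in the domain of `K` with `K ψ = φ` if and only if
`t ↦ V t ψ` is differentiable at `0` with derivative `-i φ`. -/
structure IsUnitaryGroupOf (V : ℝ → 𝓗 →L[ℂ] 𝓗) (K : 𝓗 →ₗ.[ℂ] 𝓗) : Prop where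
  unitary : ∀ t, V t ∈ unitary (𝓗 →L[ℂ] 𝓗)
  zero : V 0 = 1
  add : ∀ s t, V (s + t) = V s * V t
  continuous : ∀ ψ, Continuous fun t => V t ψ
  generator : ∀ ψ φ, (ψ, φ) ∈ K.graph ↔ HasDerivAt (fun t => V t ψ) (-Complex.I • φ) 0

/-- A densely defined operator generates at most one unitary group. -/
theorem IsUnitaryGroupOf.unique {V W : ℝ → 𝓗 →L[ℂ] 𝓗} {K : 𝓗 →ₗ.[ℂ] 𝓗}
    (hK : Dense (K.domain : Set 𝓗)) (hV : IsUnitaryGroupOf V K) (hW : IsUnitaryGroupOf W K) :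
    V = W := by
  have norm_pres : ∀ {V : ℝ → 𝓗 →L[ℂ] 𝓗}, IsUnitaryGroupOf V K →
      ∀ t x y, ⟪V t x, V t y⟫_ℂ = ⟪x, y⟫_ℂ := by
    intro V hV t x y
    have h := (Unitary.mem_iff.1 (hV.unitary t)).1
    rw [← ContinuousLinearMap.adjoint_inner_right, ← ContinuousLinearMap.star_eq_adjoint,
      ← mul_apply_eq_comp, h, one_apply_eq_self]
  have deriv_at : ∀ {V : ℝ → 𝓗 →L[ℂ] 𝓗}, IsUnitaryGroupOf V K → ∀ {x y}, (x, y) ∈ K.graph →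
      ∀ t, HasDerivAt (fun s => V s x) (V t (-Complex.I • y)) t := by
    intro V hV x y h t
    have h0 := (hV.generator x y).1 h
    have h1 : HasDerivAt (fun s => V (s - t) x) (-Complex.I • y) t := by
      have h0' : HasDerivAt (fun s => V s x) (-Complex.I • y) (t - t) := by simpa using h0
      exact HasDerivAt.comp_sub_const t t h0'
    have h2 := ((V t).restrictScalars ℝ).hasFDerivAt.comp_hasDerivAt t h1
    refine h2.congr_of_eventuallyEq (Filter.Eventually.of_forall fun s => ?_)
    change V s x = V t (V (s - t) x)
    rw [← mul_apply_eq_comp, ← hV.add]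
    congr 2
    ring
  have inv : ∀ {V : ℝ → 𝓗 →L[ℂ] 𝓗}, IsUnitaryGroupOf V K → ∀ {x y}, (x, y) ∈ K.graph →
      ∀ t, (V t x, V t y) ∈ K.graph := by
    intro V hV x y h t
    rw [hV.generator]
    have h0 := (hV.generator x y).1 h
    have h2 := ((V t).restrictScalars ℝ).hasFDerivAt.comp_hasDerivAt 0 h0
    have h3 : HasDerivAt (fun s => V s (V t x)) (V t (-Complex.I • y)) 0 := by
      refine h2.congr_of_eventuallyEq (Filter.Eventually.of_forall fun s => ?_)
      change V s (V t x) = V t (V s x)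
      rw [← mul_apply_eq_comp, ← mul_apply_eq_comp, ← hV.add, ← hV.add,
        add_comm]
    simpa using h3
  have symm : ∀ {x y x' y'}, (x, y) ∈ K.graph → (x', y') ∈ K.graph →
      ⟪y, x'⟫_ℂ = ⟪x, y'⟫_ℂ := by
    intro x y x' y' h h'
    have h1 := ((hV.generator x y).1 h).inner ℂ ((hV.generator x' y').1 h')
    simp only [norm_pres hV] at h1
    have h2 := h1.unique (hasDerivAt_const (0 : ℝ) _)
    simp only [hV.zero, one_apply_eq_self, inner_smul_left, inner_smul_right,
      map_neg, Complex.conj_I, neg_neg] at h2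
    have h3 : Complex.I * (⟪y, x'⟫_ℂ - ⟪x, y'⟫_ℂ) = 0 := by linear_combination h2
    exact sub_eq_zero.1 ((mul_eq_zero.1 h3).resolve_left Complex.I_ne_zero)
  have key : ∀ {x y x' y'}, (x, y) ∈ K.graph → (x', y') ∈ K.graph →
      ∀ t, ⟪W t x, V t x'⟫_ℂ = ⟪x, x'⟫_ℂ := by
    intro x y x' y' h h' t
    have hd : ∀ s, HasDerivAt (fun s => ⟪W s x, V s x'⟫_ℂ) 0 s := by
      intro s
      have h1 := (deriv_at hW h s).inner ℂ (deriv_at hV h' s)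
      have h2 := symm (inv hW h s) (inv hV h' s)
      refine h1.congr_deriv ?_
      simp only [map_smul, inner_smul_left, inner_smul_right, map_neg, Complex.conj_I, neg_neg, h2]
      ring
    have := is_const_of_deriv_eq_zero (fun s => (hd s).differentiableAt) (fun s => (hd s).deriv) t 0
    simpa [hV.zero, hW.zero] using this
  funext t
  refine ContinuousLinearMap.ext_on (s := (K.domain : Set 𝓗))
    (hK.mono Submodule.subset_span) fun x hx => ?_
  have hx' := K.mem_graph ⟨x, hx⟩
  have h1 : ∀ z, ⟪z, V t x - W t x⟫_ℂ = 0 := by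
    have hcl : ∀ z, ⟪W t z, V t x - W t x⟫_ℂ = 0 := by
      intro z
      refine hK.induction (P := fun z => ⟪W t z, V t x - W t x⟫_ℂ = 0) (fun z hz => ?_) ?_ z
      · rw [inner_sub_right, key (K.mem_graph ⟨z, hz⟩) hx' t, norm_pres hW, sub_self]
      · exact isClosed_eq (by fun_prop) continuous_const
    intro z
    have h := (Unitary.mem_iff.1 (hW.unitary t)).2
    have hz : W t (star (W t) z) = z := by
      rw [← mul_apply_eq_comp, h, one_apply_eq_self]
    rw [← hz]
    exact hcl _
  exact sub_eq_zero.1 (inner_self_eq_zero.1 (h1 _))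

open Classical in
/-- `evolution K t = e^{-itK}`. For self-adjoint `K` the group exists and is unique; for an
operator `K` that generates no unitary group the value is `0`. -/
def evolution (K : 𝓗 →ₗ.[ℂ] 𝓗) (t : ℝ) : 𝓗 →L[ℂ] 𝓗 :=
  if h : ∃ V, IsUnitaryGroupOf V K then h.choose t else 0

/-! ### Moments `tr[K^n ρ L^m]` of unbounded operators -/

/-- `PowGraph K n ψ φ`: the vector `ψ` lies in the domain of `K ^ n` and `K ^ n ψ = φ`. -/
def PowGraph (K : 𝓗 →ₗ.[ℂ] 𝓗) : ℕ → 𝓗 → 𝓗 → Prop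
  | 0, ψ, φ => ψ = φ
  | n + 1, ψ, φ => ∃ χ, PowGraph K n ψ χ ∧ (χ, φ) ∈ K.graph

/-- `tr[K^n ρ L^m] = c`: the operator `K^n ρ L^m` is defined on the whole (dense) domain of `L^m`,
and it extends to a bounded operator whose trace is `c`. -/
def HasMoment (K : 𝓗 →ₗ.[ℂ] 𝓗) (n : ℕ) (ρ : 𝓗 →L[ℂ] 𝓗) (L : 𝓗 →ₗ.[ℂ] 𝓗) (m : ℕ) (c : ℂ) :
    Prop :=
  ∃ X : 𝓗 →L[ℂ] 𝓗, (∀ φ η, PowGraph L m φ η → PowGraph K n (ρ η) (X φ)) ∧ HasTrace X c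

/-- The expansion
`tr[e^{-itK} ρ e^{itL}] = ∑_{n,m} tr[(-iK)^n/n! ρ (iL)^m/m!] t^(n+m)` as a power series in `t`:
all its coefficients exist, and it converges to the left-hand side for `|t| < r`. -/
def HasTracePowerSeries (K : 𝓗 →ₗ.[ℂ] 𝓗) (ρ : 𝓗 →L[ℂ] 𝓗) (L : 𝓗 →ₗ.[ℂ] 𝓗) (r : ℝ) : Prop :=
  ∃ μ : ℕ → ℕ → ℂ, (∀ n m, HasMoment K n ρ L m (μ n m)) ∧
    ∀ t : ℝ, |t| < r → ∃ z : ℂ,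
      HasTrace (evolution K t ∘L ρ ∘L evolution L (-t)) z ∧
      HasSum (fun N : ℕ => (∑ p ∈ Finset.HasAntidiagonal.antidiagonal N,
        (-Complex.I) ^ p.1 / (p.1.factorial : ℂ) * (Complex.I ^ p.2 / (p.2.factorial : ℂ)) * μ p.1 p.2)
          * (t : ℂ) ^ N) z

end OneSpace

/-! ### The Hilbert space `ℂ^n ⊗ 𝓗` -/

section Tensor

variable {n : Type*} {𝓗 : Type u} [NormedAddCommGroup 𝓗] [InnerProductSpace ℂ 𝓗]

/-- The Hilbert space tensor product `ℂ^n ⊗ 𝓗`, realised as the Hilbert direct sum of copies of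
`𝓗` indexed by `n`. -/
abbrev Tensor (n : Type*) (𝓗 : Type u) : Type _ := PiLp 2 (fun _ : n => 𝓗)

/-- `|v⟩ ⊗ 1 : 𝓗 → ℂ^n ⊗ 𝓗`, the map `ψ ↦ v ⊗ ψ`. -/
def ket (v : EuclideanSpace ℂ n) : 𝓗 →L[ℂ] Tensor n 𝓗 :=
  (PiLp.continuousLinearEquiv 2 ℂ (fun _ : n => 𝓗)).symm.toContinuousLinearMap ∘L
    ContinuousLinearMap.pi fun i => v i • ContinuousLinearMap.id ℂ 𝓗

@[simp] lemma ket_apply (v : EuclideanSpace ℂ n) (ψ : 𝓗) (i : n) :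
    ket v ψ i = v i • ψ := rfl

variable [Fintype n]

/-- `⟨v| ⊗ 1 : ℂ^n ⊗ 𝓗 → 𝓗`, the map `w ⊗ ψ ↦ ⟨v, w⟩ ψ`. -/
def bra (v : EuclideanSpace ℂ n) : Tensor n 𝓗 →L[ℂ] 𝓗 :=
  ∑ i, star (v i) • PiLp.proj 2 (fun _ : n => 𝓗) i

@[simp] lemma bra_apply (v : EuclideanSpace ℂ n) (Ψ : Tensor n 𝓗) :
    bra v Ψ = ∑ i, star (v i) • Ψ i := by
  simp [bra]

variable [DecidableEq n]

/-- The operator `M ⊗ T` on `ℂ^n ⊗ 𝓗`. -/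
def tensorOp (M : Matrix n n ℂ) (T : 𝓗 →L[ℂ] 𝓗) : Tensor n 𝓗 →L[ℂ] Tensor n 𝓗 :=
  ∑ i, ∑ j, M i j •
    (ket (EuclideanSpace.single i 1) ∘L T ∘L bra (EuclideanSpace.single j 1))

@[simp] lemma tensorOp_apply (M : Matrix n n ℂ) (T : 𝓗 →L[ℂ] 𝓗) (Ψ : Tensor n 𝓗) (i : n) :
    tensorOp M T Ψ i = ∑ j, M i j • T (Ψ j) := by
  simp only [tensorOp, sum_apply, WithLp.ofLp_sum, Finset.sum_apply]
  rw [Finset.sum_eq_single i]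
  · refine Finset.sum_congr rfl fun j _ => ?_
    simp [apply_ite (star : ℂ → ℂ), ite_smul]
  · intro k _ hk
    refine Finset.sum_eq_zero fun j _ => ?_
    simp [hk.symm]
  · simp

/-- The coefficient `H^{(l,m)}` of `|e⟩⟨f|` (with `e = E_l`, `f = E_m`) in the expansion
`H = H₀ ⊗ 1 + ∑_{l,m} |E_l⟩⟨E_m| ⊗ H^{(l,m)}`, that is, the operator
`ψ ↦ (⟨e| ⊗ 1) (H - H₀ ⊗ 1) (f ⊗ ψ)` on the domain of all `ψ` with `f ⊗ ψ` in the domain of `H`. -/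
def block (H : Tensor n 𝓗 →ₗ.[ℂ] Tensor n 𝓗) (H₀ : Matrix n n ℂ) (e f : EuclideanSpace ℂ n) :
    𝓗 →ₗ.[ℂ] 𝓗 where
  domain := H.domain.comap (ket f : 𝓗 →L[ℂ] Tensor n 𝓗).toLinearMap
  toFun :=
    { toFun := fun ψ => bra e (H ⟨ket f ψ, ψ.2⟩ - tensorOp H₀ 1 (ket f (ψ : 𝓗)))
      map_add' := fun ψ χ => by
        have h : (⟨ket f ((ψ + χ : _) : 𝓗), (ψ + χ).2⟩ : H.domain) =
            ⟨ket f ψ, ψ.2⟩ + ⟨ket f χ, χ.2⟩ := Subtype.ext (map_add (ket f) _ _)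
        rw [h, LinearPMap.map_add, Submodule.coe_add, map_add, map_add, ← map_add (bra e)]
        congr 1
        abel
      map_smul' := fun c ψ => by
        have h : (⟨ket f ((c • ψ : _) : 𝓗), (c • ψ).2⟩ : H.domain) =
            c • ⟨ket f ψ, ψ.2⟩ := Subtype.ext (map_smul (ket f) _ _)
        rw [h, LinearPMap.map_smul, Submodule.coe_smul, map_smul, map_smul, ← smul_sub, map_smul,
          RingHom.id_apply] }

/-- The expansion of `H` into its coefficients in an orthonormal basis `E`, on vectors whose
components in that basis belong to the domain. -/
theorem expansion {ι : Type*} [Fintype ι] (H : Tensor n 𝓗 →ₗ.[ℂ] Tensor n 𝓗)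
    (H₀ : Matrix n n ℂ) (E : OrthonormalBasis ι ℂ (EuclideanSpace ℂ n)) (ψ : ι → 𝓗)
    (hψ : ∀ m, ket (E m) (ψ m) ∈ H.domain) :
    (∑ m, ket (E m) (ψ m), tensorOp H₀ 1 (∑ m, ket (E m) (ψ m)) +
      ∑ l, ∑ m, ket (E l) (block H H₀ (E l) (E m) ⟨ψ m, hψ m⟩)) ∈ H.graph := by
  have resolution : ∀ Ψ : Tensor n 𝓗, ∑ l, ket (E l) (bra (E l) Ψ) = Ψ := by
    intro Ψ
    ext i
    simp only [WithLp.ofLp_sum, Finset.sum_apply, ket_apply, bra_apply, Finset.smul_sum, smul_smul]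
    rw [Finset.sum_comm, Finset.sum_eq_single i]
    · rw [← Finset.sum_smul]
      have h := E.sum_repr (EuclideanSpace.single i (1 : ℂ))
      have h := congrArg (fun v => v i) h
      simp only [WithLp.ofLp_sum, Finset.sum_apply, E.repr_apply_apply] at h
      rw [show ∑ l, E l i * star (E l i) = 1 by
        simpa [EuclideanSpace.inner_single_right, mul_comm] using h, one_smul]
    · intro j _ hj
      rw [← Finset.sum_smul]
      have h := E.sum_repr (EuclideanSpace.single j (1 : ℂ))
      have h := congrArg (fun v => v i) h
      simp only [WithLp.ofLp_sum, Finset.sum_apply, E.repr_apply_apply] at h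
      rw [show ∑ l, E l i * star (E l j) = 0 by
        simpa [EuclideanSpace.inner_single_right, mul_comm, hj.symm] using h, zero_smul]
    · simp
  have h1 : ∀ m, (ket (E m) (ψ m), H ⟨_, hψ m⟩) ∈ H.graph := fun m => H.mem_graph ⟨_, hψ m⟩
  have h2 := Submodule.sum_mem H.graph fun m (_ : m ∈ Finset.univ) => h1 m
  convert h2 using 1
  rw [Prod.ext_iff]
  refine ⟨by simp [Prod.fst_sum], ?_⟩
  simp only [Prod.snd_sum]
  rw [Finset.sum_comm, map_sum, ← Finset.sum_add_distrib]
  refine Finset.sum_congr rfl fun m _ => ?_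
  have h3 : ∀ l, block H H₀ (E l) (E m) ⟨ψ m, hψ m⟩ =
      bra (E l) (H ⟨_, hψ m⟩ - tensorOp H₀ 1 (ket (E m) (ψ m))) := by
    intro l
    rfl
  simp only [h3, resolution]
  abel

/-- The bounded operator `T` commutes with the possibly unbounded operator `H`: it maps the domain
of `H` into itself and `H T = T H` there. -/
def CommutesWith (T : Tensor n 𝓗 →L[ℂ] Tensor n 𝓗) (H : Tensor n 𝓗 →ₗ.[ℂ] Tensor n 𝓗) : Prop :=
  ∀ Ψ Φ, (Ψ, Φ) ∈ H.graph → (T Ψ, T Φ) ∈ H.graph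

end Tensor

/-- For all `k ≠ l` the power series in `t` of
`tr[e^{-itH^{(k,k)}} ρ e^{itH^{(l,l)}}]` has a radius of convergence larger than `T`. -/
def ExpansionsConverge {n ι : Type*} [Fintype n] [DecidableEq n] [Fintype ι]
    {𝓗 : Type u} [NormedAddCommGroup 𝓗] [InnerProductSpace ℂ 𝓗] [CompleteSpace 𝓗]
    (H : Tensor n 𝓗 →ₗ.[ℂ] Tensor n 𝓗) (H₀ : Matrix n n ℂ)
    (E : OrthonormalBasis ι ℂ (EuclideanSpace ℂ n)) (ρ : 𝓗 →L[ℂ] 𝓗) (T : ℝ) : Prop :=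
  ∀ k l, k ≠ l → ∃ r > T,
    HasTracePowerSeries (block H H₀ (E k) (E k)) ρ (block H H₀ (E l) (E l)) r

/-! ### System `A` with index set `a`, bath `G` with index set `g`, clock `𝓗` -/

section Thermal

variable {a g : Type*} [Fintype a] [DecidableEq a] [Fintype g] [DecidableEq g]

/-- A normalised quantum state in finite dimension. -/
structure IsDensityMatrix (ρ : Matrix a a ℂ) : Prop where
  posSemidef : ρ.PosSemidef
  trace_one : ρ.trace = 1

/-- The free Hamiltonian `H_A ⊗ 1 + 1 ⊗ H_G`. -/
def freeHamiltonian (HA : Matrix a a ℂ) (HG : Matrix g g ℂ) : Matrix (a × g) (a × g) ℂ :=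
  HA ⊗ₖ (1 : Matrix g g ℂ) + (1 : Matrix a a ℂ) ⊗ₖ HG

/-- The Gibbs state `e^{-βH} / tr e^{-βH}`. -/
def gibbs (β : ℝ) (HG : Matrix g g ℂ) : Matrix g g ℂ :=
  (NormedSpace.exp (-(β : ℂ) • HG)).trace⁻¹ • NormedSpace.exp (-(β : ℂ) • HG)

/-- Free evolution `ρ(t) = e^{-itH} ρ e^{itH}`. -/
def freeState (HA ρ : Matrix a a ℂ) (t : ℝ) : Matrix a a ℂ :=
  NormedSpace.exp ((-Complex.I * t) • HA) * ρ * NormedSpace.exp ((Complex.I * t) • HA)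

/-- The partial trace over `G` of a matrix on `A ⊗ G`. -/
def traceG (M : Matrix (a × g) (a × g) ℂ) : Matrix a a ℂ :=
  Matrix.of fun i j => ∑ k, M (i, k) (j, k)

/-- The result `tr_G[U (ρ ⊗ τ) U†]` of the thermal operation given by `U` and the bath state `τ`. -/
def thermalOp (U : Matrix (a × g) (a × g) ℂ) (τ : Matrix g g ℂ) (ρ : Matrix a a ℂ) :
    Matrix a a ℂ :=
  traceG (U * (ρ ⊗ₖ τ) * Uᴴ)

variable {𝓗 : Type u} [NormedAddCommGroup 𝓗] [InnerProductSpace ℂ 𝓗]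

/-- `tr_{G,Cl} X = M` for a bounded operator `X` on `A ⊗ G ⊗ Cl`. -/
def HasPartialTrace (X : Tensor (a × g) 𝓗 →L[ℂ] Tensor (a × g) 𝓗) (M : Matrix a a ℂ) : Prop :=
  ∀ i j, HasTrace (∑ k : g, bra (EuclideanSpace.single (i, k) 1) ∘L X ∘L
    ket (EuclideanSpace.single (j, k) 1)) (M i j)

/-- `U` is a unitary on `A ⊗ G` that preserves energy (it commutes with the free Hamiltonian, and
`U ⊗ 1` commutes with the full Hamiltonian `H`), has non-degenerate spectrum, and is diagonal in
the basis `E` (which is automatic for an energy eigenbasis `E` if the free Hamiltonian has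
non-degenerate spectrum). -/
structure IsNondegenerateEnergyPreserving {ι : Type*} [Fintype ι]
    (U H₀ : Matrix (a × g) (a × g) ℂ) (H : Tensor (a × g) 𝓗 →ₗ.[ℂ] Tensor (a × g) 𝓗)
    (E : OrthonormalBasis ι ℂ (EuclideanSpace ℂ (a × g))) : Prop where
  unitary : U ∈ Matrix.unitaryGroup (a × g) ℂ
  commute_free : Commute U H₀
  commute_full : CommutesWith (tensorOp U 1) H
  spectrum : ∃ u : ι → ℂ, Function.Injective u ∧
    ∀ l, Matrix.toEuclideanLin U (E l) = u l • E l

variable [CompleteSpace 𝓗]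

/-- The dynamics generated by `H` from the initial state `ρA ⊗ τ ⊗ ρCl` implements on `A` the free
evolution of `ρA` for times in `[0, t₁]` and the thermal operation given by `U` and `τ` for times
in `[t₂, t₃]`. -/
def Implements (HA : Matrix a a ℂ) (H : Tensor (a × g) 𝓗 →ₗ.[ℂ] Tensor (a × g) 𝓗)
    (U : Matrix (a × g) (a × g) ℂ) (τ : Matrix g g ℂ) (ρCl : 𝓗 →L[ℂ] 𝓗) (t₁ t₂ t₃ : ℝ)
    (ρA : Matrix a a ℂ) : Prop :=
  (∀ t ∈ Set.Icc 0 t₁, HasPartialTrace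
    (evolution H t ∘L tensorOp (ρA ⊗ₖ τ) ρCl ∘L evolution H (-t)) (freeState HA ρA t)) ∧
  (∀ t ∈ Set.Icc t₂ t₃, HasPartialTrace
    (evolution H t ∘L tensorOp (ρA ⊗ₖ τ) ρCl ∘L evolution H (-t))
      (thermalOp U τ (freeState HA ρA t)))

end Thermal

end

end IdealisedControl

/-!
The reason is analyticity in time. Since `U ⊗ 1` commutes with `H` and `U` has non-degenerate
spectrum in the basis `E`, the group `e^{-itH}` is block diagonal in that basis
(`IsUnitaryGroupOf.commute`, `BlockDiagonal.of_commute`), and its diagonal blocks are the groups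
generated by the operators `H^{(l,l)}`, up to the phases of the free energies
(`isUnitaryGroupOf_block`). Hence the matrix element of the reduced state between `E m` and `E l`
evolves freely, except for the factor `tr[e^{-itH^{(m,m)}} ρ e^{itH^{(l,l)}}]` contributed by the
clock (`hasPartialTrace_conj`). This factor is `1` for `m = l`, and by the assumption on the
expansions it is analytic on `[0, t₂]` otherwise. The deviation of the dynamics of `A` from the free
evolution is therefore analytic on `[0, t₂]`; it vanishes on `[0, t₁]`, so it vanishes at `t₂`,
where the dynamics is the thermal operation (`thermalOp_eq_freeState_of_implements`). So the thermal
operation fixes the freely evolved state at `t₂`, and as it commutes with the free evolution it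
fixes that state at all times (`thermalOp_fixed_of_fixed`), which is the first claim.

For the second claim, the thermal operation fixes all states of `A`. The Gibbs state is positive
definite, so no transition `⟨x, k| U |v, l⟩` with `x ⊥ v` can occur
(`ketMatrix_conj_eq_zero`), which forces `U = 1 ⊗ W` (`exists_eq_one_kronecker`). If `A` has
dimension at least two, such a `U` is degenerate (`not_injective_of_eq_one_kronecker`).

By Stone's theorem the self-adjoint operator `H` generates a unitary group, so that `evolution H` is
this group. The existence of the group need not be proved here, because it already follows from the
assumed dynamics: the state has trace one at time `0`, so `evolution H` is not its default value.
-/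

namespace IdealisedControl

/-! ### Traces -/

section Trace

universe u

variable {𝓗 : Type u} [NormedAddCommGroup 𝓗] [InnerProductSpace ℂ 𝓗]

lemma HasTrace.zero : HasTrace (0 : 𝓗 →L[ℂ] 𝓗) 0 := by
  intro κ b
  simp [hasSum_zero]

lemma HasTrace.add {X Y : 𝓗 →L[ℂ] 𝓗} {c d : ℂ} (hX : HasTrace X c) (hY : HasTrace Y d) :
    HasTrace (X + Y) (c + d) := by
  intro κ b
  simpa [inner_add_right] using (hX κ b).add (hY κ b)

lemma HasTrace.smul {X : 𝓗 →L[ℂ] 𝓗} {c : ℂ} (hX : HasTrace X c) (z : ℂ) :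
    HasTrace (z • X) (z * c) := by
  intro κ b
  simpa [inner_smul_right] using (hX κ b).mul_left z

lemma HasTrace.sum {α : Type*} (s : Finset α) {X : α → 𝓗 →L[ℂ] 𝓗} {c : α → ℂ}
    (h : ∀ i, HasTrace (X i) (c i)) : HasTrace (∑ i ∈ s, X i) (∑ i ∈ s, c i) := by
  induction s using Finset.cons_induction with
  | empty => simpa using HasTrace.zero
  | cons a s ha ih => simpa [Finset.sum_cons] using (h a).add ih

variable [CompleteSpace 𝓗]

lemma HasTrace.unique {X : 𝓗 →L[ℂ] 𝓗} {c d : ℂ} (hc : HasTrace X c) (hd : HasTrace X d) :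
    c = d := by
  obtain ⟨w, b, -⟩ := exists_hilbertBasis ℂ 𝓗
  exact (hc w b).unique (hd w b)

lemma HasTrace.conj_unitary {X W : 𝓗 →L[ℂ] 𝓗} {c : ℂ} (hX : HasTrace X c)
    (hW : W ∈ unitary (𝓗 →L[ℂ] 𝓗)) : HasTrace (W ∘L X ∘L star W) c := by
  intro κ b
  let e := Unitary.linearIsometryEquiv ⟨W, hW⟩
  let b' : HilbertBasis κ ℂ 𝓗 := HilbertBasis.ofRepr (e.trans b.repr)
  have hb' : ∀ j, b' j = star W (b j) := by
    classical
    intro j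
    have h1 : W (b' j) = b j := by
      have h2 : b.repr (e (b' j)) = b.repr (b j) := by
        rw [b.repr_self, ← b'.repr_self]
        rfl
      exact b.repr.injective h2
    rw [← h1, ← mul_apply_eq_comp, (Unitary.mem_iff.1 hW).1, one_apply_eq_self]
  have h := hX κ b'
  simp only [hb'] at h
  convert h using 2 with j
  simp only [ContinuousLinearMap.star_eq_adjoint, ContinuousLinearMap.adjoint_inner_left,
    ContinuousLinearMap.comp_apply]

end Trace

/-! ### Analyticity of convergent power series -/

/-- A complex power series in a real variable that converges on `(-r, r)` is analytic there. -/
lemma analyticAt_tsum_of_summable {a : ℕ → ℂ} {r : ℝ}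
    (h : ∀ t : ℝ, |t| < r → Summable fun N => a N * (t : ℂ) ^ N) {t : ℝ} (ht : |t| < r) :
    AnalyticAt ℝ (fun s : ℝ => ∑' N, a N * (s : ℂ) ^ N) t := by
  let p : FormalMultilinearSeries ℝ ℝ ℂ := fun n =>
    ContinuousMultilinearMap.mkPiRing ℝ (Fin n) (a n)
  have hp : ∀ n (s : ℝ), p n (fun _ => s) = a n * (s : ℂ) ^ n := by
    intro n s
    simp [p, mul_comm]
  have hr : 0 < r := (abs_nonneg t).trans_lt ht
  have hball : HasFPowerSeriesOnBall (fun s : ℝ => ∑' N, a N * (s : ℂ) ^ N) p 0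
      (ENNReal.ofReal r) := by
    refine ⟨?_, by simpa using hr, ?_⟩
    · refine le_of_forall_lt_imp_le_of_dense fun x hx => ?_
      have hx' : x ≠ ⊤ := (hx.trans ENNReal.ofReal_lt_top).ne
      lift x to NNReal using hx'
      have hxr : (x : ℝ) < r := by
        rw [← ENNReal.ofReal_coe_nnreal, ENNReal.ofReal_lt_ofReal_iff hr] at hx
        exact hx
      refine p.le_radius_of_summable ?_
      have := (h x (by simpa using hxr)).norm
      refine this.congr fun n => ?_
      simp [p]
    · intro y hy
      rw [zero_add]
      simp only [hp]
      refine (h y ?_).hasSum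
      rw [Metric.mem_eball, edist_zero_right, ← ofReal_norm,
        ENNReal.ofReal_lt_ofReal_iff hr] at hy
      simpa using hy
  refine hball.analyticAt_of_mem ?_
  rw [Metric.mem_eball, edist_zero_right, ← ofReal_norm,
    ENNReal.ofReal_lt_ofReal_iff hr]
  simpa using ht

/-! ### Unitary groups -/

section Group

universe u

variable {𝓗 : Type u} [NormedAddCommGroup 𝓗] [InnerProductSpace ℂ 𝓗] [CompleteSpace 𝓗]

lemma IsUnitaryGroupOf.neg_eq_star {V : ℝ → 𝓗 →L[ℂ] 𝓗} {K : 𝓗 →ₗ.[ℂ] 𝓗}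
    (hV : IsUnitaryGroupOf V K) (t : ℝ) : V (-t) = star (V t) := by
  have h : V t * V (-t) = 1 := by rw [← hV.add, add_neg_cancel, hV.zero]
  calc V (-t) = star (V t) * V t * V (-t) := by
        rw [(Unitary.mem_iff.1 (hV.unitary t)).1, one_mul]
    _ = star (V t) := by rw [mul_assoc, h, mul_one]

lemma evolution_eq {V : ℝ → 𝓗 →L[ℂ] 𝓗} {K : 𝓗 →ₗ.[ℂ] 𝓗} (hK : Dense (K.domain : Set 𝓗))
    (hV : IsUnitaryGroupOf V K) : evolution K = V := by
  have h : ∃ V, IsUnitaryGroupOf V K := ⟨V, hV⟩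
  rw [← IsUnitaryGroupOf.unique hK h.choose_spec hV]
  funext t
  exact dif_pos h

lemma IsUnitaryGroupOf.hasTrace_conj {V : ℝ → 𝓗 →L[ℂ] 𝓗} {K : 𝓗 →ₗ.[ℂ] 𝓗}
    (hV : IsUnitaryGroupOf V K) {X : 𝓗 →L[ℂ] 𝓗} {c : ℂ} (hX : HasTrace X c) (t : ℝ) :
    HasTrace (V t ∘L X ∘L V (-t)) c := by
  rw [hV.neg_eq_star]
  exact hX.conj_unitary (hV.unitary t)

/-- A unitary that commutes with the generator, and whose adjoint does, commutes with the group: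
conjugating the group with it gives a group with the same generator. -/
lemma IsUnitaryGroupOf.commute {V : ℝ → 𝓗 →L[ℂ] 𝓗} {K : 𝓗 →ₗ.[ℂ] 𝓗}
    (hK : Dense (K.domain : Set 𝓗)) (hV : IsUnitaryGroupOf V K) {T : 𝓗 →L[ℂ] 𝓗}
    (hT : T ∈ _root_.unitary (𝓗 →L[ℂ] 𝓗))
    (h1 : ∀ x y, (x, y) ∈ K.graph → (T x, T y) ∈ K.graph)
    (h2 : ∀ x y, (x, y) ∈ K.graph → (star T x, star T y) ∈ K.graph) (t : ℝ) :
    T * V t = V t * T := by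
  obtain ⟨hT1, hT2⟩ := Unitary.mem_iff.1 hT
  have e1 : ∀ x, star T (T x) = x := fun x => by
    rw [← mul_apply_eq_comp, hT1, one_apply_eq_self]
  have e2 : ∀ x, T (star T x) = x := fun x => by
    rw [← mul_apply_eq_comp, hT2, one_apply_eq_self]
  have hW : IsUnitaryGroupOf (fun t => T * V t * star T) K := by
    refine ⟨fun t => ?_, ?_, fun s t => ?_, fun ψ => ?_, fun ψ φ => ?_⟩
    · exact mul_mem (mul_mem hT (hV.unitary t)) (Unitary.star_mem hT)
    · simp [hV.zero, hT2]
    · rw [hV.add]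
      calc T * (V s * V t) * star T = T * V s * 1 * V t * star T := by
            simp only [mul_one, mul_assoc]
        _ = _ := by rw [← hT1]; simp only [mul_assoc]
    · exact T.continuous.comp (hV.continuous _)
    · have hg : (ψ, φ) ∈ K.graph ↔ (star T ψ, star T φ) ∈ K.graph :=
        ⟨h2 _ _, fun h => by simpa only [e2] using h1 _ _ h⟩
      rw [hg, hV.generator]
      refine ⟨fun h => ?_, fun h => ?_⟩
      · have := (T.restrictScalars ℝ).hasFDerivAt.comp_hasDerivAt 0 h
        refine this.congr_deriv ?_
        simp [e2]
      · have := ((star T).restrictScalars ℝ).hasFDerivAt.comp_hasDerivAt 0 h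
        refine (this.congr_deriv ?_).congr_of_eventuallyEq
          (Filter.Eventually.of_forall fun s => ?_)
        · simp
        · simp [e1]
  have h := congrFun (IsUnitaryGroupOf.unique hK hW hV) t
  calc T * V t = T * V t * star T * T := by rw [mul_assoc _ (star T), hT1, mul_one]
    _ = V t * T := by rw [show T * V t * star T = V t from h]

/-- If a bounded operator commutes with a self-adjoint operator, so does its adjoint. -/
lemma star_mem_graph_of_isSelfAdjoint {K : 𝓗 →ₗ.[ℂ] 𝓗} (hK : IsSelfAdjoint K) {T : 𝓗 →L[ℂ] 𝓗}
    (h : ∀ x y, (x, y) ∈ K.graph → (T x, T y) ∈ K.graph) {x y : 𝓗} (hxy : (x, y) ∈ K.graph) :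
    (star T x, star T y) ∈ K.graph := by
  have hd := hK.dense_domain
  have hg : K.graph = K.graph.adjoint := by
    rw [← LinearPMap.adjoint_graph_eq_graph_adjoint hd, LinearPMap.isSelfAdjoint_def.1 hK]
  rw [hg, Submodule.mem_adjoint_iff] at hxy ⊢
  intro a b hab
  have := hxy _ _ (h a b hab)
  simpa only [ContinuousLinearMap.star_eq_adjoint, ContinuousLinearMap.adjoint_inner_right]
    using this

end Group

/-! ### The Hilbert space `ℂ^n ⊗ 𝓗` -/

section Tensor

universe u

variable {n ι : Type*} [Fintype n] [Fintype ι]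
  {𝓗 : Type u} [NormedAddCommGroup 𝓗] [InnerProductSpace ℂ 𝓗]

lemma bra_ket (v w : EuclideanSpace ℂ n) (ψ : 𝓗) : bra v (ket w ψ) = ⟪v, w⟫_ℂ • ψ := by
  simp only [bra_apply, ket_apply, smul_smul, ← Finset.sum_smul, PiLp.inner_apply,
    RCLike.inner_apply]
  congr 1
  exact Finset.sum_congr rfl fun i _ => mul_comm _ _

lemma ket_smul (c : ℂ) (v : EuclideanSpace ℂ n) :
    (ket (c • v) : 𝓗 →L[ℂ] Tensor n 𝓗) = c • ket v := by
  ext ψ i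
  simp [smul_smul]

lemma ket_sum {α : Type*} (s : Finset α) (v : α → EuclideanSpace ℂ n) :
    (ket (∑ l ∈ s, v l) : 𝓗 →L[ℂ] Tensor n 𝓗) = ∑ l ∈ s, ket (v l) := by
  ext ψ i
  simp [Finset.sum_smul]

lemma bra_smul (c : ℂ) (v : EuclideanSpace ℂ n) :
    (bra (c • v) : Tensor n 𝓗 →L[ℂ] 𝓗) = star c • bra v := by
  ext ψ
  simp [smul_smul, Finset.smul_sum]

lemma bra_sum {α : Type*} (s : Finset α) (v : α → EuclideanSpace ℂ n) :
    (bra (∑ l ∈ s, v l) : Tensor n 𝓗 →L[ℂ] 𝓗) = ∑ l ∈ s, bra (v l) := by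
  ext ψ
  simp [Finset.sum_smul]
  rw [Finset.sum_comm]

lemma inner_ket_left (v : EuclideanSpace ℂ n) (ψ : 𝓗) (Ψ : Tensor n 𝓗) :
    ⟪ket v ψ, Ψ⟫_ℂ = ⟪ψ, bra v Ψ⟫_ℂ := by
  simp [PiLp.inner_apply, inner_smul_left]

lemma bra_ket_self (E : OrthonormalBasis ι ℂ (EuclideanSpace ℂ n)) (l : ι) (ψ : 𝓗) :
    bra (E l) (ket (E l) ψ) = ψ := by
  rw [bra_ket, inner_self_eq_norm_sq_to_K, E.norm_eq_one]
  simp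

/-- The group generated by `H^{(l,l)}`: the diagonal block of `e^{-itH}`, with the phase of the
free energy removed. -/
noncomputable def blockGroup (V : ℝ → Tensor n 𝓗 →L[ℂ] Tensor n 𝓗) (v : EuclideanSpace ℂ n)
    (e t : ℝ) : 𝓗 →L[ℂ] 𝓗 :=
  Complex.exp (Complex.I * e * t) • (bra v ∘L V t ∘L ket v)

lemma bra_comp_ket_eq_smul_blockGroup (V : ℝ → Tensor n 𝓗 →L[ℂ] Tensor n 𝓗)
    (v : EuclideanSpace ℂ n) (e t : ℝ) :
    bra v ∘L V t ∘L ket v = Complex.exp (-(Complex.I * e * t)) • blockGroup V v e t := by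
  rw [blockGroup, smul_smul, ← Complex.exp_add]
  simp

variable [DecidableEq n]

lemma tensorOp_ket (M : Matrix n n ℂ) (T : 𝓗 →L[ℂ] 𝓗) (v : EuclideanSpace ℂ n) (ψ : 𝓗) :
    tensorOp M T (ket v ψ) = ket (Matrix.toEuclideanLin M v) (T ψ) := by
  ext i
  simp [smul_smul, Finset.sum_smul, Matrix.mulVec, dotProduct]

lemma bra_tensorOp_ket (M : Matrix n n ℂ) (T : 𝓗 →L[ℂ] 𝓗) (v w : EuclideanSpace ℂ n) :
    bra v ∘L tensorOp M T ∘L ket w = ⟪v, Matrix.toEuclideanLin M w⟫_ℂ • T := by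
  ext ψ
  simp [tensorOp_ket, bra_ket, -bra_apply]

lemma single_eq_sum (E : OrthonormalBasis ι ℂ (EuclideanSpace ℂ n)) (x : n) :
    EuclideanSpace.single x (1 : ℂ) = ∑ l, star (E l x) • E l := by
  rw [← E.sum_repr (EuclideanSpace.single x (1 : ℂ))]
  simp [E.repr_apply_apply, EuclideanSpace.inner_single_right]

lemma ket_single (E : OrthonormalBasis ι ℂ (EuclideanSpace ℂ n)) (x : n) :
    (ket (EuclideanSpace.single x 1) : 𝓗 →L[ℂ] Tensor n 𝓗) = ∑ l, star (E l x) • ket (E l) := by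
  rw [single_eq_sum E, ket_sum]
  simp only [ket_smul]

lemma bra_single (E : OrthonormalBasis ι ℂ (EuclideanSpace ℂ n)) (x : n) :
    (bra (EuclideanSpace.single x 1) : Tensor n 𝓗 →L[ℂ] 𝓗) = ∑ l, E l x • bra (E l) := by
  rw [single_eq_sum E, bra_sum]
  simp only [bra_smul, star_star]

lemma sum_ket_bra (E : OrthonormalBasis ι ℂ (EuclideanSpace ℂ n)) (Ψ : Tensor n 𝓗) :
    ∑ l, ket (E l) (bra (E l) Ψ) = Ψ := by
  have h1 : ∀ Φ : Tensor n 𝓗, Φ = ∑ x, ket (EuclideanSpace.single x 1) (Φ x) := by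
    intro Φ
    ext i
    rw [WithLp.ofLp_sum, Finset.sum_apply, Finset.sum_eq_single i]
    · simp
    · intro j _ hj
      simp [hj.symm]
    · simp
  rw [h1 Ψ]
  simp only [map_sum, bra_ket]
  rw [Finset.sum_comm]
  refine Finset.sum_congr rfl fun x _ => ?_
  conv_rhs => rw [ket_single E]
  simp [EuclideanSpace.inner_single_right, -bra_apply]

lemma bra_tensorOp_apply {U : Matrix n n ℂ} {E : OrthonormalBasis ι ℂ (EuclideanSpace ℂ n)}
    {u : ι → ℂ} (hE : ∀ l, Matrix.toEuclideanLin U (E l) = u l • E l) (k : ι) (Ψ : Tensor n 𝓗) :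
    bra (E k) (tensorOp U 1 Ψ) = u k • bra (E k) Ψ := by
  conv_lhs => rw [← sum_ket_bra E Ψ]
  simp only [map_sum, tensorOp_ket, hE, ket_smul, smul_apply, map_smul, one_apply_eq_self]
  rw [Finset.sum_eq_single k]
  · rw [bra_ket, inner_self_eq_norm_sq_to_K, E.norm_eq_one]
    simp [-bra_apply]
  · intro m _ hm
    rw [bra_ket, E.inner_eq_zero hm.symm]
    simp
  · simp

/-- `X` has no off-diagonal blocks in the basis `E` of `ℂ^n`. -/
def BlockDiagonal (E : OrthonormalBasis ι ℂ (EuclideanSpace ℂ n))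
    (X : Tensor n 𝓗 →L[ℂ] Tensor n 𝓗) : Prop :=
  ∀ k l, k ≠ l → ∀ ψ, bra (E k) (X (ket (E l) ψ)) = 0

/-- An operator on `ℂ^n ⊗ 𝓗` that commutes with `U ⊗ 1`, where the vectors `E l` are eigenvectors
of `U` for distinct eigenvalues, is block diagonal. -/
lemma BlockDiagonal.of_commute {U : Matrix n n ℂ} {E : OrthonormalBasis ι ℂ (EuclideanSpace ℂ n)}
    {u : ι → ℂ} (hu : Function.Injective u)
    (hE : ∀ l, Matrix.toEuclideanLin U (E l) = u l • E l)
    {X : Tensor n 𝓗 →L[ℂ] Tensor n 𝓗} (hX : tensorOp U 1 * X = X * tensorOp U 1) :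
    BlockDiagonal E X := by
  intro k l hkl ψ
  have h1 := congrArg (fun Y => bra (E k) (Y (ket (E l) ψ))) hX
  simp only [mul_apply_eq_comp] at h1
  rw [tensorOp_ket, hE, ket_smul, bra_tensorOp_apply hE, smul_apply, map_smul, map_smul,
    one_apply_eq_self, ← sub_eq_zero, ← sub_smul] at h1
  exact (smul_eq_zero.1 h1).resolve_left (sub_ne_zero.2 fun h => hkl (hu h))

lemma BlockDiagonal.apply_ket {E : OrthonormalBasis ι ℂ (EuclideanSpace ℂ n)}
    {X : Tensor n 𝓗 →L[ℂ] Tensor n 𝓗} (hX : BlockDiagonal E X) (l : ι) (ψ : 𝓗) :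
    X (ket (E l) ψ) = ket (E l) (bra (E l) (X (ket (E l) ψ))) := by
  conv_lhs => rw [← sum_ket_bra E (X (ket (E l) ψ))]
  refine Finset.sum_eq_single l (fun k _ hk => ?_) (by simp)
  rw [hX k l hk, map_zero]

lemma BlockDiagonal.bra_apply {E : OrthonormalBasis ι ℂ (EuclideanSpace ℂ n)}
    {X : Tensor n 𝓗 →L[ℂ] Tensor n 𝓗} (hX : BlockDiagonal E X) (l : ι) (Ψ : Tensor n 𝓗) :
    bra (E l) (X Ψ) = bra (E l) (X (ket (E l) (bra (E l) Ψ))) := by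
  conv_lhs => rw [← sum_ket_bra E Ψ, map_sum, map_sum]
  refine Finset.sum_eq_single l (fun k _ hk => ?_) (by simp)
  exact hX l k hk.symm _

lemma tensorOp_one_mul_tensorOp_one (M N : Matrix n n ℂ) :
    (tensorOp M 1 * tensorOp N 1 : Tensor n 𝓗 →L[ℂ] Tensor n 𝓗) = tensorOp (M * N) 1 := by
  ext Ψ i
  simp only [mul_apply_eq_comp, tensorOp_apply, one_apply_eq_self, Matrix.mul_apply,
    Finset.sum_smul, Finset.smul_sum, smul_smul]
  exact Finset.sum_comm

lemma tensorOp_one_one : (tensorOp 1 1 : Tensor n 𝓗 →L[ℂ] Tensor n 𝓗) = 1 := by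
  ext Ψ i
  simp [Matrix.one_apply]

lemma star_tensorOp_one [CompleteSpace 𝓗] (M : Matrix n n ℂ) :
    star (tensorOp M 1 : Tensor n 𝓗 →L[ℂ] Tensor n 𝓗) = tensorOp Mᴴ 1 := by
  rw [ContinuousLinearMap.star_eq_adjoint, eq_comm, ContinuousLinearMap.eq_adjoint_iff]
  intro x y
  simp only [PiLp.inner_apply, tensorOp_apply, one_apply_eq_self, sum_inner, inner_sum,
    inner_smul_left, inner_smul_right, Matrix.conjTranspose_apply, starRingEnd_apply, star_star]
  exact Finset.sum_comm

lemma tensorOp_mem_unitary [CompleteSpace 𝓗] {U : Matrix n n ℂ}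
    (hU : U ∈ Matrix.unitaryGroup n ℂ) :
    tensorOp U 1 ∈ unitary (Tensor n 𝓗 →L[ℂ] Tensor n 𝓗) := by
  rw [Matrix.mem_unitaryGroup_iff, Matrix.star_eq_conjTranspose] at hU
  rw [Unitary.mem_iff, star_tensorOp_one, tensorOp_one_mul_tensorOp_one,
    tensorOp_one_mul_tensorOp_one, hU, mul_eq_one_comm.1 hU, tensorOp_one_one]
  exact ⟨rfl, rfl⟩

end Tensor

/-! ### The unitary groups generated by the diagonal blocks -/

section Blocks

universe u

variable {n ι : Type*} [Fintype n] [DecidableEq n] [Fintype ι]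
  {𝓗 : Type u} [NormedAddCommGroup 𝓗] [InnerProductSpace ℂ 𝓗]
  {H : Tensor n 𝓗 →ₗ.[ℂ] Tensor n 𝓗} {H₀ : Matrix n n ℂ}
  {E : OrthonormalBasis ι ℂ (EuclideanSpace ℂ n)} {V : ℝ → Tensor n 𝓗 →L[ℂ] Tensor n 𝓗}

lemma mem_graph_block {l : ι} {e : ℝ} (he : Matrix.toEuclideanLin H₀ (E l) = (e : ℂ) • E l)
    (ψ φ : 𝓗) : (ψ, φ) ∈ (block H H₀ (E l) (E l)).graph ↔
      ∃ χ, (ket (E l) ψ, χ) ∈ H.graph ∧ bra (E l) χ - (e : ℂ) • ψ = φ := by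
  have hb : ∀ χ, bra (E l) (χ - tensorOp H₀ 1 (ket (E l) ψ)) = bra (E l) χ - (e : ℂ) • ψ := by
    intro χ
    rw [map_sub, tensorOp_ket, he, ket_smul, smul_apply, map_smul, bra_ket_self,
      one_apply_eq_self]
  simp only [LinearPMap.mem_graph_iff, Subtype.exists, exists_and_left, exists_eq_left]
  constructor
  · rintro ⟨h, rfl⟩
    exact ⟨_, ⟨h, rfl⟩, (hb _).symm⟩
  · rintro ⟨_, ⟨h, rfl⟩, rfl⟩
    exact ⟨h, hb _⟩

/-- The block `⟨E_k| e^{-itH} (M ⊗ ρ) e^{itH} |E_l⟩`. -/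
lemma bra_conj_tensorOp_ket (hd : ∀ t, BlockDiagonal E (V t)) (e : ι → ℝ)
    (M : Matrix n n ℂ) (ρ : 𝓗 →L[ℂ] 𝓗) (k l : ι) (t : ℝ) :
    bra (E k) ∘L (V t ∘L tensorOp M ρ ∘L V (-t)) ∘L ket (E l) =
      (Complex.exp (-(Complex.I * e k * t)) * Complex.exp (Complex.I * e l * t) *
        ⟪E k, Matrix.toEuclideanLin M (E l)⟫_ℂ) •
        (blockGroup V (E k) (e k) t ∘L ρ ∘L blockGroup V (E l) (e l) (-t)) := by
  have h1 : bra (E k) ∘L (V t ∘L tensorOp M ρ ∘L V (-t)) ∘L ket (E l) =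
      (bra (E k) ∘L V t ∘L ket (E k)) ∘L (bra (E k) ∘L tensorOp M ρ ∘L ket (E l)) ∘L
        (bra (E l) ∘L V (-t) ∘L ket (E l)) := by
    ext ψ
    simp only [ContinuousLinearMap.comp_apply]
    rw [← (hd (-t)).apply_ket, ← (hd t).bra_apply]
  rw [h1, bra_tensorOp_ket, bra_comp_ket_eq_smul_blockGroup _ _ (e k),
    bra_comp_ket_eq_smul_blockGroup _ _ (e l)]
  ext ψ
  simp only [ContinuousLinearMap.comp_apply, smul_apply, map_smul, smul_smul]
  congr 1
  push_cast
  ring_nf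

variable [CompleteSpace 𝓗]

/-- The domain of a diagonal block is dense: it contains the projection of the domain of `H`. -/
lemma dense_domain_block (hH : Dense (H.domain : Set (Tensor n 𝓗))) (hV : IsUnitaryGroupOf V H)
    (hd : ∀ t, BlockDiagonal E (V t)) (l : ι) :
    Dense ((block H H₀ (E l) (E l)).domain : Set 𝓗) := by
  have hr : DenseRange (bra (E l) : Tensor n 𝓗 →L[ℂ] 𝓗) :=
    Function.Surjective.denseRange fun ψ => ⟨ket (E l) ψ, bra_ket_self E l ψ⟩
  refine (hr.dense_image (bra (E l)).continuous hH).mono ?_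
  rintro _ ⟨Ψ, hΨ, rfl⟩
  have h1 := (hV.generator _ _).1 (H.mem_graph ⟨Ψ, hΨ⟩)
  -- The projection onto the block commutes with the group, hence preserves differentiability.
  have h2 := ((ket (E l) ∘L bra (E l) : Tensor n 𝓗 →L[ℂ] Tensor n 𝓗).restrictScalars
    ℝ).hasFDerivAt.comp_hasDerivAt 0 h1
  have h3 : (ket (E l) (bra (E l) Ψ), ket (E l) (bra (E l) (H ⟨Ψ, hΨ⟩))) ∈ H.graph := by
    rw [hV.generator]
    refine (h2.congr_deriv ?_).congr_of_eventuallyEq (Filter.Eventually.of_forall fun t => ?_)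
    · simp [-bra_apply]
    · beta_reduce
      rw [(hd t).apply_ket, ← (hd t).bra_apply]
      rfl
  exact H.mem_domain_of_mem_graph h3

/-- If `e^{-itH}` is block diagonal, its diagonal blocks are, up to the phases of the free energies,
the unitary groups generated by the diagonal blocks of `H`. -/
lemma isUnitaryGroupOf_block (hV : IsUnitaryGroupOf V H) (hd : ∀ t, BlockDiagonal E (V t))
    {l : ι} {e : ℝ} (he : Matrix.toEuclideanLin H₀ (E l) = (e : ℂ) • E l) :
    IsUnitaryGroupOf (blockGroup V (E l) e) (block H H₀ (E l) (E l)) := by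
  have h0 : blockGroup V (E l) e 0 = 1 := by
    ext ψ
    simp [blockGroup, hV.zero, bra_ket_self, -bra_apply]
  have hadd : ∀ s t, blockGroup V (E l) e (s + t) =
      blockGroup V (E l) e s * blockGroup V (E l) e t := by
    intro s t
    ext ψ
    have h1 : bra (E l) (V (s + t) (ket (E l) ψ)) =
        bra (E l) (V s (ket (E l) (bra (E l) (V t (ket (E l) ψ))))) := by
      rw [← (hd t).apply_ket, ← mul_apply_eq_comp, ← hV.add]
    simp only [blockGroup, mul_apply_eq_comp, smul_apply, ContinuousLinearMap.comp_apply, map_smul,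
      h1, smul_smul, ← Complex.exp_add]
    congr 2
    push_cast
    ring
  have hstar : ∀ t, star (blockGroup V (E l) e t) = blockGroup V (E l) e (-t) := by
    intro t
    rw [ContinuousLinearMap.star_eq_adjoint, eq_comm, ContinuousLinearMap.eq_adjoint_iff]
    intro x y
    simp only [blockGroup, smul_apply, ContinuousLinearMap.comp_apply, inner_smul_left,
      inner_smul_right]
    congr 1
    · rw [← Complex.exp_conj]
      simp
    · rw [← inner_ket_left, hV.neg_eq_star, ContinuousLinearMap.star_eq_adjoint,
        ← inner_conj_symm, ← inner_ket_left, inner_conj_symm,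
        ContinuousLinearMap.adjoint_inner_left]
  refine ⟨fun t => ?_, h0, hadd, fun ψ => ?_, fun ψ φ => ?_⟩
  · rw [Unitary.mem_iff, hstar, ← hadd, ← hadd]
    simp [h0]
  · have h1 : Continuous fun t => V t (ket (E l) ψ) := hV.continuous _
    have h2 : Continuous fun t : ℝ => Complex.exp (Complex.I * e * t) := by fun_prop
    exact h2.smul ((bra (E l)).continuous.comp h1)
  · have hexp : ∀ c : ℂ, HasDerivAt (fun t : ℝ => Complex.exp (c * t)) c 0 := by
      intro c
      have h1 : HasDerivAt (fun t : ℂ => Complex.exp (c * t)) (Complex.exp (c * 0) * (c * 1))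
          ((0 : ℝ) : ℂ) := by
        have := ((hasDerivAt_id ((0 : ℝ) : ℂ)).const_mul c).cexp
        simpa using this
      simpa using h1.comp_ofReal
    have hbk : bra (E l) (V 0 (ket (E l) ψ)) = ψ := by
      rw [hV.zero, one_apply_eq_self, bra_ket_self]
    rw [mem_graph_block he]
    constructor
    · rintro ⟨χ, hχ, rfl⟩
      have h1 := (hV.generator _ _).1 hχ
      have h2 := ((bra (E l) : Tensor n 𝓗 →L[ℂ] 𝓗).restrictScalars
        ℝ).hasFDerivAt.comp_hasDerivAt 0 h1
      refine ((hexp (Complex.I * e)).smul h2).congr_deriv ?_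
      simp [hbk, -bra_apply]
      module
    · intro h
      have h1 : HasDerivAt (fun t => bra (E l) (V t (ket (E l) ψ)))
          (-Complex.I • (φ + (e : ℂ) • ψ)) 0 := by
        refine (((hexp (-(Complex.I * e))).smul h).congr_deriv ?_).congr_of_eventuallyEq
          (Filter.Eventually.of_forall fun t => ?_)
        · simp [h0, -bra_apply]
          module
        · have := congrArg (fun X => X ψ) (bra_comp_ket_eq_smul_blockGroup V (E l) e t)
          simpa [-bra_apply] using this
      have h2 := ((ket (E l) : 𝓗 →L[ℂ] Tensor n 𝓗).restrictScalars
        ℝ).hasFDerivAt.comp_hasDerivAt 0 h1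
      refine ⟨ket (E l) (φ + (e : ℂ) • ψ), ?_, by rw [bra_ket_self, add_sub_cancel_right]⟩
      rw [hV.generator]
      refine (h2.congr_deriv ?_).congr_of_eventuallyEq (Filter.Eventually.of_forall fun t => ?_)
      · simp
      · exact (hd t).apply_ket l ψ

end Blocks

/-! ### Matrix exponentials and energy eigenvectors -/

section Exponential

variable {n ι : Type*} [Fintype n] [DecidableEq n] [Fintype ι]

lemma map_matrix_exp {m : Type*} [Fintype m] [DecidableEq m]
    (f : Matrix n n ℂ →+* Matrix m m ℂ) (hf : Continuous f) (M : Matrix n n ℂ) :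
    f (NormedSpace.exp M) = NormedSpace.exp (f M) := by
  open scoped Matrix.Norms.Operator in
  exact NormedSpace.map_exp f hf M

lemma toEuclideanLin_exp_apply {M : Matrix n n ℂ} {v : EuclideanSpace ℂ n} {c : ℂ}
    (h : Matrix.toEuclideanLin M v = c • v) (z : ℂ) :
    Matrix.toEuclideanLin (NormedSpace.exp (z • M)) v = Complex.exp (z * c) • v := by
  have hpow : ∀ k : ℕ, Matrix.toEuclideanLin ((z • M) ^ k) v = (z * c) ^ k • v := by
    intro k
    induction k with
    | zero => simp
    | succ k ih =>
      have h1 : Matrix.toEuclideanLin ((z • M) ^ (k + 1)) v =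
          Matrix.toEuclideanLin (z • M) (Matrix.toEuclideanLin ((z • M) ^ k) v) := by
        ext i
        simp [pow_succ']
      rw [h1, ih, map_smul, map_smul, LinearMap.smul_apply, h, smul_smul, smul_smul, pow_succ,
        mul_assoc]
  have h1 : HasSum (fun k : ℕ => ((k.factorial : ℂ)⁻¹) • (z • M) ^ k)
      (NormedSpace.exp (z • M)) := by
    open scoped Matrix.Norms.Operator in
    exact NormedSpace.exp_series_hasSum_exp' (𝕂 := ℂ) (z • M)
  let F : Matrix n n ℂ →ₗ[ℂ] EuclideanSpace ℂ n :=
    (LinearMap.applyₗ v) ∘ₗ (Matrix.toEuclideanLin (𝕜 := ℂ) (m := n) (n := n)).toLinearMap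
  have h2 := h1.map F F.continuous_of_finiteDimensional
  have h3 : HasSum (fun k : ℕ => ((k.factorial : ℂ)⁻¹ • (z * c) ^ k) • v)
      (Complex.exp (z * c) • v) := by
    rw [Complex.exp_eq_exp_ℂ]
    exact (NormedSpace.exp_series_hasSum_exp' (𝕂 := ℂ) (z * c)).smul_const v
  refine h2.unique ?_
  convert h3 using 2 with k
  simp only [Function.comp_apply, map_smul, smul_assoc]
  exact congrArg _ (hpow k)

lemma exp_smul_mul_exp_smul (M : Matrix n n ℂ) (z w : ℂ) :
    NormedSpace.exp (z • M) * NormedSpace.exp (w • M) = NormedSpace.exp ((z + w) • M) := by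
  rw [add_smul, Matrix.exp_add_of_commute _ _ ((Commute.refl M).smul_left z |>.smul_right w)]

lemma exp_smul_conjTranspose {M : Matrix n n ℂ} (hM : M.IsHermitian) (z : ℂ) :
    (NormedSpace.exp (z • M))ᴴ = NormedSpace.exp (star z • M) := by
  rw [← Matrix.exp_conjTranspose, Matrix.conjTranspose_smul, hM.eq]

lemma commute_exp {M N : Matrix n n ℂ} (h : Commute M N) (z : ℂ) :
    Commute M (NormedSpace.exp (z • N)) := by
  open scoped Matrix.Norms.Operator in
  exact (h.smul_right z).exp_right

lemma inner_toEuclideanLin_left (M : Matrix n n ℂ) (v w : EuclideanSpace ℂ n) :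
    ⟪v, Matrix.toEuclideanLin M w⟫_ℂ = ⟪Matrix.toEuclideanLin Mᴴ v, w⟫_ℂ := by
  rw [Matrix.toEuclideanLin_conjTranspose_eq_adjoint, LinearMap.adjoint_inner_left]

lemma toEuclideanLin_mul_apply (M N : Matrix n n ℂ) (v : EuclideanSpace ℂ n) :
    Matrix.toEuclideanLin (M * N) v = Matrix.toEuclideanLin M (Matrix.toEuclideanLin N v) := by
  ext i
  simp [Matrix.mulVec_mulVec]

/-- Matrix elements of the free evolution of `M` in an energy eigenbasis. -/
lemma inner_exp_conj {H₀ : Matrix n n ℂ} (hH₀ : H₀.IsHermitian)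
    {v w : EuclideanSpace ℂ n} {x y : ℝ} (hv : Matrix.toEuclideanLin H₀ v = (x : ℂ) • v)
    (hw : Matrix.toEuclideanLin H₀ w = (y : ℂ) • w) (M : Matrix n n ℂ) (t : ℝ) :
    ⟪v, Matrix.toEuclideanLin (NormedSpace.exp ((-Complex.I * t) • H₀) * M *
      NormedSpace.exp ((Complex.I * t) • H₀)) w⟫_ℂ =
      Complex.exp (-(Complex.I * x * t)) * Complex.exp (Complex.I * y * t) *
        ⟪v, Matrix.toEuclideanLin M w⟫_ℂ := by
  rw [toEuclideanLin_mul_apply, toEuclideanLin_mul_apply, toEuclideanLin_exp_apply hw,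
    inner_toEuclideanLin_left, exp_smul_conjTranspose hH₀, toEuclideanLin_exp_apply hv,
    map_smul, inner_smul_left, inner_smul_right, ← Complex.exp_conj, ← mul_assoc]
  congr 2
  · simp only [map_mul, map_neg, Complex.conj_I, Complex.conj_ofReal, RCLike.star_def, neg_neg]
    ring_nf
  · ring_nf

lemma apply_eq_sum_inner (E : OrthonormalBasis ι ℂ (EuclideanSpace ℂ n)) (N : Matrix n n ℂ)
    (x y : n) :
    N x y = ∑ m, ∑ l, E m x * star (E l y) * ⟪E m, Matrix.toEuclideanLin N (E l)⟫_ℂ := by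
  have h1 : N x y = ⟪EuclideanSpace.single x (1 : ℂ),
      Matrix.toEuclideanLin N (EuclideanSpace.single y 1)⟫_ℂ := by
    simp [EuclideanSpace.inner_single_left]
  rw [h1, single_eq_sum E x, single_eq_sum E y, sum_inner]
  refine Finset.sum_congr rfl fun m _ => ?_
  rw [map_sum, inner_sum]
  refine Finset.sum_congr rfl fun l _ => ?_
  rw [map_smul, inner_smul_left, inner_smul_right]
  simp [mul_assoc]

end Exponential

/-! ### Partial traces and thermal operations -/

section Thermal

variable {a g ι : Type*} [Fintype a] [DecidableEq a] [Fintype g] [DecidableEq g] [Fintype ι]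

/-- The matrix element `⟨i| tr_G(|v⟩⟨w|) |j⟩`. -/
noncomputable def partialTraceWeight (v w : EuclideanSpace ℂ (a × g)) (i j : a) : ℂ :=
  ∑ k, v (i, k) * star (w (j, k))

lemma traceG_apply_eq_sum (E : OrthonormalBasis ι ℂ (EuclideanSpace ℂ (a × g)))
    (N : Matrix (a × g) (a × g) ℂ) (i j : a) :
    traceG N i j = ∑ m, ∑ l, partialTraceWeight (E m) (E l) i j *
      ⟪E m, Matrix.toEuclideanLin N (E l)⟫_ℂ := by
  simp only [traceG, Matrix.of_apply, partialTraceWeight, Finset.sum_mul]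
  rw [Finset.sum_congr rfl fun k _ => apply_eq_sum_inner E N (i, k) (j, k), Finset.sum_comm]
  refine Finset.sum_congr rfl fun m _ => ?_
  rw [Finset.sum_comm]

omit [Fintype a] [DecidableEq a] [DecidableEq g] in
lemma traceG_kronecker (A : Matrix a a ℂ) (B : Matrix g g ℂ) :
    traceG (A ⊗ₖ B) = B.trace • A := by
  ext i j
  simp [traceG, Matrix.trace, ← Finset.mul_sum, mul_comm]

omit [DecidableEq a] in
lemma traceG_kronecker_one_mul (A : Matrix a a ℂ) (N : Matrix (a × g) (a × g) ℂ) :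
    traceG ((A ⊗ₖ (1 : Matrix g g ℂ)) * N) = A * traceG N := by
  ext i j
  simp only [traceG, Matrix.mul_apply, Matrix.of_apply, Fintype.sum_prod_type,
    Matrix.kroneckerMap_apply, Matrix.one_apply, mul_ite, mul_one, mul_zero, ite_mul, zero_mul,
    Finset.sum_ite_eq, Finset.mem_univ, if_true, Finset.mul_sum]
  exact Finset.sum_comm

omit [DecidableEq a] in
lemma traceG_mul_kronecker_one (A : Matrix a a ℂ) (N : Matrix (a × g) (a × g) ℂ) :
    traceG (N * (A ⊗ₖ (1 : Matrix g g ℂ))) = traceG N * A := by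
  ext i j
  simp only [traceG, Matrix.mul_apply, Matrix.of_apply, Fintype.sum_prod_type,
    Matrix.kroneckerMap_apply, Matrix.one_apply, mul_ite, mul_one, mul_zero, 
    Finset.sum_ite_eq', Finset.mem_univ, if_true, Finset.sum_mul]
  exact Finset.sum_comm

omit [DecidableEq g] in
lemma traceG_one_kronecker_mul (B : Matrix g g ℂ) (N : Matrix (a × g) (a × g) ℂ) :
    traceG (((1 : Matrix a a ℂ) ⊗ₖ B) * N) = traceG (N * ((1 : Matrix a a ℂ) ⊗ₖ B)) := by
  ext i j
  simp only [traceG, Matrix.mul_apply, Matrix.of_apply, Fintype.sum_prod_type_right,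
    Matrix.kroneckerMap_apply, Matrix.one_apply, mul_ite, one_mul, mul_zero, ite_mul, zero_mul,
    Finset.sum_ite_eq, Finset.sum_ite_eq', Finset.mem_univ, if_true]
  rw [Finset.sum_comm]
  exact Finset.sum_congr rfl fun _ _ => Finset.sum_congr rfl fun _ _ => mul_comm _ _

lemma traceG_kronecker_conj (A A' : Matrix a a ℂ) {B B' : Matrix g g ℂ} (hB : B' * B = 1)
    (N : Matrix (a × g) (a × g) ℂ) :
    traceG ((A ⊗ₖ B) * N * (A' ⊗ₖ B')) = A * traceG N * A' := by
  have h1 : A ⊗ₖ B = (A ⊗ₖ (1 : Matrix g g ℂ)) * ((1 : Matrix a a ℂ) ⊗ₖ B) := by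
    rw [← Matrix.mul_kronecker_mul, mul_one, one_mul]
  have h2 : A' ⊗ₖ B' = ((1 : Matrix a a ℂ) ⊗ₖ B') * (A' ⊗ₖ (1 : Matrix g g ℂ)) := by
    rw [← Matrix.mul_kronecker_mul, mul_one, one_mul]
  have h3 : (A ⊗ₖ B) * N * (A' ⊗ₖ B') = (A ⊗ₖ (1 : Matrix g g ℂ)) *
      (((1 : Matrix a a ℂ) ⊗ₖ B) * N * ((1 : Matrix a a ℂ) ⊗ₖ B')) *
        (A' ⊗ₖ (1 : Matrix g g ℂ)) := by
    rw [h1, h2]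
    simp only [mul_assoc]
  rw [h3, traceG_mul_kronecker_one, traceG_kronecker_one_mul, mul_assoc _ N,
    traceG_one_kronecker_mul, mul_assoc N, ← Matrix.mul_kronecker_mul, hB, one_mul,
    Matrix.one_kronecker_one, mul_one]

lemma exp_freeHamiltonian (HA : Matrix a a ℂ) (HG : Matrix g g ℂ) (z : ℂ) :
    NormedSpace.exp (z • freeHamiltonian HA HG) =
      NormedSpace.exp (z • HA) ⊗ₖ NormedSpace.exp (z • HG) := by
  let f : Matrix a a ℂ →+* Matrix (a × g) (a × g) ℂ :=
    { toFun := fun M => M ⊗ₖ (1 : Matrix g g ℂ)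
      map_one' := Matrix.one_kronecker_one
      map_mul' := fun M N => by rw [← Matrix.mul_kronecker_mul, one_mul]
      map_zero' := Matrix.zero_kronecker _
      map_add' := fun M N => Matrix.add_kronecker _ _ _ }
  let f' : Matrix g g ℂ →+* Matrix (a × g) (a × g) ℂ :=
    { toFun := fun M => (1 : Matrix a a ℂ) ⊗ₖ M
      map_one' := Matrix.one_kronecker_one
      map_mul' := fun M N => by rw [← Matrix.mul_kronecker_mul, one_mul]
      map_zero' := Matrix.kronecker_zero _
      map_add' := fun M N => Matrix.kronecker_add _ _ _ }
  have hf : Continuous f := continuous_matrix fun x y => by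
    change Continuous fun M : Matrix a a ℂ => M x.1 y.1 * (1 : Matrix g g ℂ) x.2 y.2
    fun_prop
  have hf' : Continuous f' := continuous_matrix fun x y => by
    change Continuous fun M : Matrix g g ℂ => (1 : Matrix a a ℂ) x.1 y.1 * M x.2 y.2
    fun_prop
  have h1 : z • freeHamiltonian HA HG = f (z • HA) + f' (z • HG) := by
    rw [freeHamiltonian, smul_add, ← Matrix.smul_kronecker, ← Matrix.kronecker_smul]
    rfl
  have hc : Commute (f (z • HA)) (f' (z • HG)) := by
    change _ ⊗ₖ _ * _ ⊗ₖ _ = _ ⊗ₖ _ * _ ⊗ₖ _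
    rw [← Matrix.mul_kronecker_mul, ← Matrix.mul_kronecker_mul]
    simp
  rw [h1, Matrix.exp_add_of_commute _ _ hc, ← map_matrix_exp f hf, ← map_matrix_exp f' hf']
  change _ ⊗ₖ _ * _ ⊗ₖ _ = _
  rw [← Matrix.mul_kronecker_mul, mul_one, one_mul]

omit [Fintype a] [Fintype g] in
lemma isHermitian_freeHamiltonian {HA : Matrix a a ℂ} {HG : Matrix g g ℂ} (hHA : HA.IsHermitian)
    (hHG : HG.IsHermitian) : (freeHamiltonian HA HG).IsHermitian := by
  rw [Matrix.IsHermitian, freeHamiltonian, Matrix.conjTranspose_add,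
    Matrix.conjTranspose_kronecker, Matrix.conjTranspose_kronecker, hHA.eq, hHG.eq,
    Matrix.conjTranspose_one, Matrix.conjTranspose_one]

lemma posDef_exp_smul {HG : Matrix g g ℂ} (hHG : HG.IsHermitian) (r : ℝ) :
    (NormedSpace.exp ((r : ℂ) • HG)).PosDef := by
  have h1 : NormedSpace.exp ((r : ℂ) • HG) =
      (NormedSpace.exp (((r / 2 : ℝ) : ℂ) • HG))ᴴ * NormedSpace.exp (((r / 2 : ℝ) : ℂ) • HG) := by
    rw [exp_smul_conjTranspose hHG, exp_smul_mul_exp_smul]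
    congr 2
    simp
  rw [h1]
  exact Matrix.PosDef.conjTranspose_mul_self _
    (Matrix.mulVec_injective_of_isUnit (Matrix.isUnit_exp _))

lemma trace_exp_smul_pos [Nonempty g] {HG : Matrix g g ℂ} (hHG : HG.IsHermitian) (r : ℝ) :
    0 < (NormedSpace.exp ((r : ℂ) • HG)).trace :=
  (posDef_exp_smul hHG r).trace_pos

lemma trace_gibbs [Nonempty g] {HG : Matrix g g ℂ} (hHG : HG.IsHermitian) (β : ℝ) :
    (gibbs β HG).trace = 1 := by
  have h := (trace_exp_smul_pos hHG (-β)).ne'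
  push_cast at h
  rw [gibbs, Matrix.trace_smul, smul_eq_mul, inv_mul_cancel₀ h]

lemma posDef_gibbs [Nonempty g] {HG : Matrix g g ℂ} (hHG : HG.IsHermitian) (β : ℝ) :
    (gibbs β HG).PosDef := by
  have h := trace_exp_smul_pos hHG (-β)
  have h2 := posDef_exp_smul hHG (-β)
  push_cast at h h2
  exact h2.smul (inv_pos.2 h)

lemma commute_gibbs_exp (HG : Matrix g g ℂ) (β : ℝ) (z : ℂ) :
    Commute (gibbs β HG) (NormedSpace.exp (z • HG)) := by
  refine Commute.smul_left ?_ _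
  exact commute_exp (commute_exp (Commute.refl HG) _).symm z

lemma freeState_add (HA ρ : Matrix a a ℂ) (s t : ℝ) :
    freeState HA (freeState HA ρ s) t = freeState HA ρ (t + s) := by
  have h1 : ((-Complex.I * ((t + s : ℝ) : ℂ)) : ℂ) = -Complex.I * t + -Complex.I * s := by
    push_cast; ring
  have h2 : ((Complex.I * ((t + s : ℝ) : ℂ)) : ℂ) = Complex.I * s + Complex.I * t := by
    push_cast; ring
  simp only [freeState]
  rw [h1, h2, ← exp_smul_mul_exp_smul, ← exp_smul_mul_exp_smul]
  simp only [mul_assoc]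

lemma freeState_zero (HA ρ : Matrix a a ℂ) : freeState HA ρ 0 = ρ := by
  simp [freeState]

lemma isDensityMatrix_freeState {HA ρ : Matrix a a ℂ} (hHA : HA.IsHermitian)
    (hρ : IsDensityMatrix ρ) (t : ℝ) : IsDensityMatrix (freeState HA ρ t) := by
  have h1 : NormedSpace.exp ((Complex.I * t) • HA) =
      (NormedSpace.exp ((-Complex.I * t) • HA))ᴴ := by
    rw [exp_smul_conjTranspose hHA]
    simp
  refine ⟨?_, ?_⟩
  · rw [freeState, h1]
    exact hρ.posSemidef.mul_mul_conjTranspose_same _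
  · rw [freeState, Matrix.trace_mul_cycle, exp_smul_mul_exp_smul]
    simp [hρ.trace_one]

/-- The free evolution of `A` and `G` leaves the Gibbs state of `G` invariant. -/
lemma freeState_kronecker_gibbs (HA ρ : Matrix a a ℂ) (HG : Matrix g g ℂ) (β t : ℝ) :
    freeState HA ρ t ⊗ₖ gibbs β HG =
      NormedSpace.exp ((-Complex.I * t) • freeHamiltonian HA HG) * (ρ ⊗ₖ gibbs β HG) *
        NormedSpace.exp ((Complex.I * t) • freeHamiltonian HA HG) := by
  rw [exp_freeHamiltonian, exp_freeHamiltonian, ← Matrix.mul_kronecker_mul,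
    ← Matrix.mul_kronecker_mul, ← (commute_gibbs_exp HG β _).eq, mul_assoc (gibbs β HG),
    exp_smul_mul_exp_smul]
  simp [freeState]

lemma traceG_exp_conj_kronecker_gibbs [Nonempty g] (HA ρ : Matrix a a ℂ) {HG : Matrix g g ℂ}
    (hHG : HG.IsHermitian) (β t : ℝ) :
    traceG (NormedSpace.exp ((-Complex.I * t) • freeHamiltonian HA HG) * (ρ ⊗ₖ gibbs β HG) *
        NormedSpace.exp ((Complex.I * t) • freeHamiltonian HA HG)) = freeState HA ρ t := by
  rw [← freeState_kronecker_gibbs, traceG_kronecker, trace_gibbs hHG, one_smul]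

/-- Thermal operations commute with the free evolution. -/
lemma thermalOp_freeState {HA : Matrix a a ℂ} {HG : Matrix g g ℂ} (hHA : HA.IsHermitian)
    (hHG : HG.IsHermitian) (β : ℝ) {U : Matrix (a × g) (a × g) ℂ}
    (hU : Commute U (freeHamiltonian HA HG)) (ρ : Matrix a a ℂ) (t : ℝ) :
    thermalOp U (gibbs β HG) (freeState HA ρ t) =
      freeState HA (thermalOp U (gibbs β HG) ρ) t := by
  have h1 := commute_exp hU (-Complex.I * t)
  have h2 : Commute Uᴴ (NormedSpace.exp ((Complex.I * t) • freeHamiltonian HA HG)) := by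
    have h3 := congrArg Matrix.conjTranspose h1.eq
    rw [Matrix.conjTranspose_mul, Matrix.conjTranspose_mul,
      exp_smul_conjTranspose (isHermitian_freeHamiltonian hHA hHG)] at h3
    rw [Commute, SemiconjBy]
    simpa using h3.symm
  rw [thermalOp, freeState_kronecker_gibbs]
  have h3 : ∀ W W' M : Matrix (a × g) (a × g) ℂ, Commute U W → Commute Uᴴ W' →
      U * (W * M * W') * Uᴴ = W * (U * M * Uᴴ) * W' := by
    intro W W' M hW hW'
    calc U * (W * M * W') * Uᴴ = (U * W) * M * (W' * Uᴴ) := by simp only [mul_assoc]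
      _ = _ := by rw [hW.eq, ← hW'.eq]; simp only [mul_assoc]
  rw [h3 _ _ _ h1 h2, exp_freeHamiltonian, exp_freeHamiltonian, traceG_kronecker_conj, freeState,
    thermalOp]
  rw [exp_smul_mul_exp_smul]
  simp

/-- By covariance, a thermal operation that fixes one state of a free trajectory fixes all of
them. -/
lemma thermalOp_fixed_of_fixed {HA : Matrix a a ℂ} {HG : Matrix g g ℂ} (hHA : HA.IsHermitian)
    (hHG : HG.IsHermitian) (β : ℝ) {U : Matrix (a × g) (a × g) ℂ}
    (hU : Commute U (freeHamiltonian HA HG)) (ρ : Matrix a a ℂ) {s : ℝ}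
    (h : thermalOp U (gibbs β HG) (freeState HA ρ s) = freeState HA ρ s) (t : ℝ) :
    thermalOp U (gibbs β HG) (freeState HA ρ t) = freeState HA ρ t := by
  have h1 : freeState HA ρ t = freeState HA (freeState HA ρ s) (t - s) := by
    rw [freeState_add, sub_add_cancel]
  rw [h1, thermalOp_freeState hHA hHG β hU, h]

end Thermal

/-! ### Trivial thermal operations -/

section Trivial

variable {a g ι : Type*} [Fintype a] [DecidableEq a] [Fintype g] [DecidableEq g] [Fintype ι]

variable (g) in
/-- The matrix of `v ⊗ 1 : ℂ^g → ℂ^a ⊗ ℂ^g`. -/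
def ketMatrix (v : a → ℂ) : Matrix (a × g) g ℂ :=
  Matrix.of fun x k => if x.2 = k then v x.1 else 0

omit [Fintype a] [DecidableEq a] in
lemma ketMatrix_mul_mul_conjTranspose (v : a → ℂ) (τ : Matrix g g ℂ) :
    ketMatrix g v * τ * (ketMatrix g v)ᴴ = Matrix.vecMulVec v (star v) ⊗ₖ τ := by
  ext x y
  simp [ketMatrix, Matrix.mul_apply, Matrix.vecMulVec_apply, apply_ite (star : ℂ → ℂ)]
  ring

omit [DecidableEq a] in
lemma trace_ketMatrix_conj (x : a → ℂ) (N : Matrix (a × g) (a × g) ℂ) :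
    ((ketMatrix g x)ᴴ * N * ketMatrix g x).trace = star x ⬝ᵥ (traceG N *ᵥ x) := by
  simp only [Matrix.trace, Matrix.diag, Matrix.mul_apply, ketMatrix, Matrix.conjTranspose_apply,
    Matrix.of_apply, Fintype.sum_prod_type, apply_ite (star : ℂ → ℂ), star_zero, ite_mul, zero_mul,
    mul_ite, mul_zero, Finset.sum_ite_eq', Finset.mem_univ, if_true, dotProduct, Matrix.mulVec,
    traceG, Finset.sum_mul, Finset.mul_sum, Pi.star_apply]
  rw [Finset.sum_comm]
  conv_lhs => enter [2, y]; rw [Finset.sum_comm]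
  rw [Finset.sum_comm]
  refine Finset.sum_congr rfl fun i _ => Finset.sum_congr rfl fun j _ =>
    Finset.sum_congr rfl fun k _ => by ring

omit [DecidableEq a] in
lemma ketMatrix_conj_apply (x v : a → ℂ) (U : Matrix (a × g) (a × g) ℂ) (k l : g) :
    ((ketMatrix g x)ᴴ * U * ketMatrix g v) k l = ∑ j, ∑ i, star (x i) * U (i, k) (j, l) * v j := by
  simp [Matrix.mul_apply, ketMatrix, Fintype.sum_prod_type, apply_ite (star : ℂ → ℂ),
    Finset.sum_mul]

lemma thermalOp_smul (U : Matrix (a × g) (a × g) ℂ) (τ : Matrix g g ℂ) (c : ℂ)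
    (ρ : Matrix a a ℂ) : thermalOp U τ (c • ρ) = c • thermalOp U τ ρ := by
  ext i j
  simp [thermalOp, traceG, Matrix.smul_kronecker, Finset.mul_sum]

omit [DecidableEq a] in
/-- If a thermal operation fixes the pure state `v`, then `⟨x, k| U |v, l⟩ = 0` for all `x ⊥ v`:
the population of `x` in the output is a sum of non-negative terms, one for each transition. -/
lemma ketMatrix_conj_eq_zero {U : Matrix (a × g) (a × g) ℂ} {τ : Matrix g g ℂ} (hτ : τ.PosDef)
    {x v : a → ℂ} (h : thermalOp U τ (Matrix.vecMulVec v (star v)) = Matrix.vecMulVec v (star v))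
    (hxv : star x ⬝ᵥ v = 0) : (ketMatrix g x)ᴴ * U * ketMatrix g v = (0 : Matrix g g ℂ) := by
  obtain ⟨B, hB⟩ : ∃ B : Matrix g g ℂ, B = (ketMatrix g x)ᴴ * U * ketMatrix g v := ⟨_, rfl⟩
  rw [← hB]
  have h1 : (B * τ * Bᴴ).trace = 0 := by
    have h2 : B * τ * Bᴴ = (ketMatrix g x)ᴴ *
        (U * (Matrix.vecMulVec v (star v) ⊗ₖ τ) * Uᴴ) * ketMatrix g x := by
      rw [← ketMatrix_mul_mul_conjTranspose, hB]
      simp only [Matrix.conjTranspose_mul, Matrix.conjTranspose_conjTranspose, Matrix.mul_assoc]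
    rw [h2, trace_ketMatrix_conj]
    change star x ⬝ᵥ (thermalOp U τ _ *ᵥ x) = 0
    rw [h, Matrix.vecMulVec_mulVec]
    simp [dotProduct_smul, hxv]
  have h2 : B * τ * Bᴴ = 0 :=
    (hτ.posSemidef.mul_mul_conjTranspose_same B).trace_eq_zero_iff.1 h1
  have h3 : ∀ w, Bᴴ *ᵥ w = 0 := by
    intro w
    by_contra hw
    have h4 := hτ.dotProduct_mulVec_pos hw
    have h5 : star (Bᴴ *ᵥ w) ⬝ᵥ (τ *ᵥ (Bᴴ *ᵥ w)) = star w ⬝ᵥ ((B * τ * Bᴴ) *ᵥ w) := by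
      rw [Matrix.star_mulVec, Matrix.conjTranspose_conjTranspose, ← Matrix.dotProduct_mulVec,
        Matrix.mulVec_mulVec, Matrix.mulVec_mulVec, mul_assoc]
    rw [h5, h2] at h4
    simp at h4
  have h4 : Bᴴ = 0 := Matrix.ext_of_mulVec_single fun i => by rw [h3, Matrix.zero_mulVec]
  simpa using h4

/-- A unitary whose thermal operation is the identity acts on the bath only. -/
lemma exists_eq_one_kronecker {U : Matrix (a × g) (a × g) ℂ} {τ : Matrix g g ℂ} (hτ : τ.PosDef)
    (h : ∀ ρ : Matrix a a ℂ, IsDensityMatrix ρ → thermalOp U τ ρ = ρ) :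
    ∃ W : Matrix g g ℂ, U = (1 : Matrix a a ℂ) ⊗ₖ W := by
  have hpure : ∀ v : a → ℂ,
      thermalOp U τ (Matrix.vecMulVec v (star v)) = Matrix.vecMulVec v (star v) := by
    intro v
    by_cases hv : v = 0
    · subst hv
      have := thermalOp_smul U τ 0 (0 : Matrix a a ℂ)
      simpa using this
    have hpos : 0 < v ⬝ᵥ star v := by
      rw [dotProduct_comm]
      exact Matrix.dotProduct_star_self_pos_iff.2 hv
    have hd : IsDensityMatrix ((v ⬝ᵥ star v)⁻¹ • Matrix.vecMulVec v (star v)) :=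
      ⟨(Matrix.posSemidef_vecMulVec_self_star v).smul (inv_pos.2 hpos).le, by
        rw [Matrix.trace_smul, Matrix.trace_vecMulVec, smul_eq_mul, inv_mul_cancel₀ hpos.ne']⟩
    have h1 := h _ hd
    rw [thermalOp_smul] at h1
    exact smul_right_injective _ (inv_ne_zero hpos.ne') h1
  have hoff : ∀ i j, i ≠ j → ∀ k l, U (i, k) (j, l) = 0 := by
    intro i j hij k l
    have h1 := ketMatrix_conj_eq_zero hτ (hpure (Pi.single j 1)) (x := Pi.single i 1)
      (by simp [hij])
    have h2 := congrFun (congrFun h1 k) l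
    rw [ketMatrix_conj_apply] at h2
    simpa [Pi.single_apply, apply_ite (star : ℂ → ℂ)] using h2
  -- `|i⟩ - |j⟩` is orthogonal to `|i⟩ + |j⟩`, which compares the diagonal blocks.
  have hdiag : ∀ i j k l, U (i, k) (i, l) = U (j, k) (j, l) := by
    intro i j k l
    by_cases hij : i = j
    · rw [hij]
    have h1 := ketMatrix_conj_eq_zero hτ (hpure (Pi.single i 1 + Pi.single j 1))
      (x := Pi.single i 1 - Pi.single j 1) (by simp [hij, Ne.symm hij])
    have h2 := congrFun (congrFun h1 k) l
    rw [ketMatrix_conj_apply] at h2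
    simp only [Pi.sub_apply, Pi.add_apply, star_sub, sub_mul, mul_add, Pi.single_apply,
      apply_ite (star : ℂ → ℂ), star_one, star_zero, ite_mul, mul_ite, one_mul, zero_mul, mul_one,
      mul_zero, Finset.sum_add_distrib, Matrix.zero_apply] at h2
    simp [hoff i j hij, hoff j i (Ne.symm hij)] at h2
    linear_combination h2
  rcases isEmpty_or_nonempty a with ha | ⟨⟨i₀⟩⟩
  · exact ⟨0, Matrix.ext fun x => ha.elim x.1⟩
  refine ⟨Matrix.of fun k l => U (i₀, k) (i₀, l), ?_⟩
  ext ⟨i, k⟩ ⟨j, l⟩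
  by_cases hij : i = j
  · subst hij
    simpa using hdiag i i₀ k l
  · simp [hoff i j hij, hij]

omit [DecidableEq a] [DecidableEq g] in
/-- For non-degenerate eigenvalues the eigenspaces are spanned by the vectors of the basis. -/
lemma eq_smul_of_eigenvector {n : Type*} [Fintype n] [DecidableEq n] {U : Matrix n n ℂ}
    {E : OrthonormalBasis ι ℂ (EuclideanSpace ℂ n)} {u : ι → ℂ} (hu : Function.Injective u)
    (hE : ∀ l, Matrix.toEuclideanLin U (E l) = u l • E l) {l : ι} {v : EuclideanSpace ℂ n}
    (hv : Matrix.toEuclideanLin U v = u l • v) : ∃ c : ℂ, v = c • E l := by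
  have h1 : ∀ m, E.repr (Matrix.toEuclideanLin U v) m = u m * E.repr v m := by
    classical
    intro m
    conv_lhs => rw [← E.sum_repr v]
    simp [hE, Pi.single_apply, mul_comm]
  refine ⟨E.repr v l, ?_⟩
  conv_lhs => rw [← E.sum_repr v]
  refine Finset.sum_eq_single l (fun m _ hm => ?_) (by simp)
  have h2 := h1 m
  rw [hv, map_smul, PiLp.smul_apply, smul_eq_mul, ← sub_eq_zero, ← sub_mul] at h2
  rw [(mul_eq_zero.1 h2).resolve_left (sub_ne_zero.2 fun h => hm (hu h).symm), zero_smul]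

/-- A unitary that acts on the bath only is degenerate: its eigenspaces contain `|i⟩ ⊗ s` for a
fixed `s` and all `i`. -/
lemma not_injective_of_eq_one_kronecker [Nonempty g] (ha : 2 ≤ Fintype.card a) {W : Matrix g g ℂ}
    {E : OrthonormalBasis ι ℂ (EuclideanSpace ℂ (a × g))} {u : ι → ℂ}
    (hE : ∀ l, Matrix.toEuclideanLin ((1 : Matrix a a ℂ) ⊗ₖ W) (E l) = u l • E l) :
    ¬ Function.Injective u := by
  intro hu
  have : Nontrivial a := Fintype.one_lt_card_iff_nontrivial.1 ha
  have hι : Nonempty ι := by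
    obtain ⟨x⟩ := (inferInstance : Nonempty (a × g))
    by_contra hemp
    rw [not_nonempty_iff] at hemp
    have := E.sum_repr (EuclideanSpace.single x (1 : ℂ))
    rw [Finset.univ_eq_empty, Finset.sum_empty] at this
    simpa using congrArg (fun v => v x) this
  obtain ⟨l⟩ := hι
  obtain ⟨⟨i, k⟩, hik⟩ : ∃ x, E l x ≠ 0 := by
    by_contra! h
    exact E.orthonormal.ne_zero l (by ext x; simpa using h x)
  obtain ⟨j, hj⟩ := exists_ne i
  have hs : ∀ p, ∑ q, W p q * E l (i, q) = u l * E l (i, p) := by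
    intro p
    have := congrArg (fun v => v (i, p)) (hE l)
    simpa [Matrix.mulVec, dotProduct, Fintype.sum_prod_type, Matrix.one_apply] using this
  let v : EuclideanSpace ℂ (a × g) :=
    WithLp.toLp 2 fun x => if x.1 = j then E l (i, x.2) else 0
  have hv : Matrix.toEuclideanLin ((1 : Matrix a a ℂ) ⊗ₖ W) v = u l • v := by
    ext ⟨i', p⟩
    by_cases hi' : i' = j
    · simpa [v, Matrix.mulVec, dotProduct, Fintype.sum_prod_type, Matrix.one_apply, hi'] using hs p
    · simp [v, Matrix.mulVec, dotProduct, Fintype.sum_prod_type, Matrix.one_apply, hi']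
  obtain ⟨c, hc⟩ := eq_smul_of_eigenvector hu hE hv
  have h1 : c * E l (i, k) = 0 := by
    have := congrArg (fun v => v (i, k)) hc
    simpa [v, hj.symm] using this.symm
  have h2 : E l (i, k) = c * E l (j, k) := by
    have := congrArg (fun v => v (j, k)) hc
    simpa [v] using this
  rw [(mul_eq_zero.1 h1).resolve_right hik, zero_mul] at h2
  exact hik h2

end Trivial

/-! ### The dynamics of the system and its analytic continuation in time -/

section Dynamics

universe u

variable {a g ι : Type*} [Fintype a] [DecidableEq a] [Fintype g] [DecidableEq g] [Fintype ι]
  {𝓗 : Type u} [NormedAddCommGroup 𝓗] [InnerProductSpace ℂ 𝓗]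

lemma HasPartialTrace.eq_zero [CompleteSpace 𝓗] {M : Matrix a a ℂ}
    (h : HasPartialTrace (0 : Tensor (a × g) 𝓗 →L[ℂ] Tensor (a × g) 𝓗) M) : M = 0 := by
  ext i j
  exact (h i j).unique (by simpa using HasTrace.zero)

/-- The reduced dynamics for a block-diagonal group: each matrix element in the energy eigenbasis
evolves freely, times the trace of the clock between the two corresponding blocks. -/
lemma hasPartialTrace_conj {E : OrthonormalBasis ι ℂ (EuclideanSpace ℂ (a × g))}
    {V : ℝ → Tensor (a × g) 𝓗 →L[ℂ] Tensor (a × g) 𝓗} (hd : ∀ t, BlockDiagonal E (V t))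
    (e : ι → ℝ) (M : Matrix (a × g) (a × g) ℂ) {ρ : 𝓗 →L[ℂ] 𝓗} {t : ℝ} {z : ι → ι → ℂ}
    (hz : ∀ m l, HasTrace
      (blockGroup V (E m) (e m) t ∘L ρ ∘L blockGroup V (E l) (e l) (-t)) (z m l)) :
    HasPartialTrace (V t ∘L tensorOp M ρ ∘L V (-t)) (Matrix.of fun i j =>
      ∑ m, ∑ l, partialTraceWeight (E m) (E l) i j *
        (Complex.exp (-(Complex.I * e m * t)) * Complex.exp (Complex.I * e l * t) *
          ⟪E m, Matrix.toEuclideanLin M (E l)⟫_ℂ * z m l)) := by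
  intro i j
  have h1 : ∀ X : Tensor (a × g) 𝓗 →L[ℂ] Tensor (a × g) 𝓗,
      ∑ k : g, bra (EuclideanSpace.single (i, k) 1) ∘L X ∘L ket (EuclideanSpace.single (j, k) 1) =
        ∑ m, ∑ l, partialTraceWeight (E m) (E l) i j • (bra (E m) ∘L X ∘L ket (E l)) := by
    intro X
    simp only [partialTraceWeight, Finset.sum_smul]
    rw [Finset.sum_congr rfl fun m _ => Finset.sum_comm, Finset.sum_comm]
    refine Finset.sum_congr rfl fun k _ => ?_
    rw [bra_single E, ket_single E]
    ext ψ
    simp only [ContinuousLinearMap.comp_apply, sum_apply, smul_apply, map_sum, map_smul,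
      Finset.smul_sum, smul_smul]
    rw [Finset.sum_comm]
    exact Finset.sum_congr rfl fun _ _ => Finset.sum_congr rfl fun _ _ => by rw [mul_comm]
  rw [h1]
  refine HasTrace.sum _ fun m => HasTrace.sum _ fun l => HasTrace.smul ?_ _
  rw [bra_conj_tensorOp_ket hd e]
  exact (hz m l).smul _

variable [CompleteSpace 𝓗]

/-- If the power series converges, the trace continues analytically to all times of interest. -/
lemma HasTracePowerSeries.exists_analyticAt {K L : 𝓗 →ₗ.[ℂ] 𝓗} {ρ : 𝓗 →L[ℂ] 𝓗} {r T : ℝ}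
    (h : HasTracePowerSeries K ρ L r) (hr : T < r) :
    ∃ Z : ℝ → ℂ, ∀ t ∈ Set.Icc 0 T, AnalyticAt ℝ Z t ∧
      HasTrace (evolution K t ∘L ρ ∘L evolution L (-t)) (Z t) := by
  obtain ⟨μ, -, h⟩ := h
  refine ⟨fun t => ∑' N, (∑ p ∈ Finset.HasAntidiagonal.antidiagonal N,
    (-Complex.I) ^ p.1 / (p.1.factorial : ℂ) * (Complex.I ^ p.2 / (p.2.factorial : ℂ)) *
      μ p.1 p.2) * (t : ℂ) ^ N, fun t ht => ?_⟩
  have htr : |t| < r := by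
    rw [abs_of_nonneg ht.1]
    exact ht.2.trans_lt hr
  refine ⟨analyticAt_tsum_of_summable (fun s hs => ?_) htr, ?_⟩
  · obtain ⟨z, -, hz⟩ := h s hs
    exact hz.summable
  · obtain ⟨z, hz, hs⟩ := h t htr
    beta_reduce
    rwa [hs.tsum_eq]

lemma analyticAt_cexp_mul (c : ℂ) (t : ℝ) :
    AnalyticAt ℝ (fun s : ℝ => Complex.exp (c * s)) t := by
  have h1 : AnalyticAt ℝ (fun s : ℝ => (s : ℂ)) t := Complex.ofRealCLM.analyticAt t
  have h2 : AnalyticAt ℝ (fun z : ℂ => Complex.exp (c * z)) (t : ℂ) :=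
    AnalyticAt.restrictScalars (𝕜' := ℂ) (analyticAt_const.mul analyticAt_id).cexp
  exact h2.comp h1

/-- If the dynamics is free up to a positive time, and the traces of the clock are analytic, then
the dynamics is free at `t₂`, where it is also the thermal operation. -/
lemma thermalOp_eq_freeState_of_implements {HA : Matrix a a ℂ} (hHA : HA.IsHermitian)
    {HG : Matrix g g ℂ} (hHG : HG.IsHermitian) {β : ℝ}
    {H : Tensor (a × g) 𝓗 →ₗ.[ℂ] Tensor (a × g) 𝓗} (hH : IsSelfAdjoint H)
    {E : OrthonormalBasis ι ℂ (EuclideanSpace ℂ (a × g))}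
    (hE : ∀ l, ∃ e : ℝ, Matrix.toEuclideanLin (freeHamiltonian HA HG) (E l) = (e : ℂ) • E l)
    {ρCl : 𝓗 →L[ℂ] 𝓗} (hρCl : IsDensityOperator ρCl) {t₁ t₂ t₃ : ℝ} (ht₁ : 0 < t₁)
    (ht₂ : t₁ < t₂) (ht₃ : t₂ < t₃)
    (hexp : ExpansionsConverge H (freeHamiltonian HA HG) E ρCl t₂)
    {U : Matrix (a × g) (a × g) ℂ}
    (hU : IsNondegenerateEnergyPreserving U (freeHamiltonian HA HG) H E)
    {ρA : Matrix a a ℂ} (hρA : IsDensityMatrix ρA)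
    (himp : Implements HA H U (gibbs β HG) ρCl t₁ t₂ t₃ ρA) :
    Nonempty g ∧
      thermalOp U (gibbs β HG) (freeState HA ρA t₂) = freeState HA ρA t₂ := by
  obtain ⟨hfree, htherm⟩ := himp
  have hzero : ∀ {X : Tensor (a × g) 𝓗 →L[ℂ] Tensor (a × g) 𝓗},
      HasPartialTrace X (freeState HA ρA 0) → X ≠ 0 := by
    rintro _ h rfl
    have h1 := (isDensityMatrix_freeState hHA hρA 0).trace_one
    rw [h.eq_zero] at h1
    simp at h1
  have h0 := hzero (hfree 0 ⟨le_rfl, ht₁.le⟩)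
  have hg : Nonempty g := by
    by_contra hg
    rw [not_nonempty_iff] at hg
    refine h0 ?_
    ext Ψ x
    exact isEmptyElim x.2
  refine ⟨hg, ?_⟩
  -- The state has trace one at time `0`, so `evolution H` is not its default value.
  obtain ⟨V, hV⟩ : ∃ V, IsUnitaryGroupOf V H := by
    by_contra hne
    refine h0 ?_
    simp [evolution, hne]
  have hdense := hH.dense_domain
  rw [evolution_eq hdense hV] at hfree htherm
  obtain ⟨u, hu, hUE⟩ := hU.spectrum
  have hT : tensorOp U 1 ∈ unitary (Tensor (a × g) 𝓗 →L[ℂ] Tensor (a × g) 𝓗) :=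
    tensorOp_mem_unitary hU.unitary
  have hd : ∀ t, BlockDiagonal E (V t) := fun t =>
    BlockDiagonal.of_commute hu hUE <| hV.commute hdense hT hU.commute_full
      (fun _ _ => star_mem_graph_of_isSelfAdjoint hH hU.commute_full) t
  choose e he using hE
  have hblock : ∀ l, evolution (block H (freeHamiltonian HA HG) (E l) (E l)) =
      blockGroup V (E l) (e l) := fun l =>
    evolution_eq (dense_domain_block hdense hV hd l) (isUnitaryGroupOf_block hV hd (he l))
  have hZ : ∀ m l, ∃ Z : ℝ → ℂ, ∀ t ∈ Set.Icc 0 t₂, AnalyticAt ℝ Z t ∧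
      HasTrace (blockGroup V (E m) (e m) t ∘L ρCl ∘L blockGroup V (E l) (e l) (-t)) (Z t) := by
    intro m l
    rw [← hblock, ← hblock]
    by_cases hml : m = l
    · subst hml
      refine ⟨fun _ => 1, fun t _ => ⟨analyticAt_const, ?_⟩⟩
      rw [hblock]
      exact (isUnitaryGroupOf_block hV hd (he m)).hasTrace_conj hρCl.trace_one t
    · obtain ⟨r, hr, h⟩ := hexp m l hml
      exact h.exists_analyticAt hr
  choose Z hZ using hZ
  have htrace := fun t (ht : t ∈ Set.Icc 0 t₂) =>
    hasPartialTrace_conj hd e (ρA ⊗ₖ gibbs β HG) (fun m l => (hZ m l t ht).2)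
  ext i j
  -- The deviation of the dynamics from the free evolution: without the clock, all traces `Z m l`
  -- would be `1`.
  let D : ℝ → ℂ := fun t => ∑ m, ∑ l, partialTraceWeight (E m) (E l) i j *
    (Complex.exp (-(Complex.I * e m) * t) * Complex.exp (Complex.I * e l * t) *
      ⟪E m, Matrix.toEuclideanLin (ρA ⊗ₖ gibbs β HG) (E l)⟫_ℂ * (Z m l t - 1))
  have hD : ∀ t ∈ Set.Icc 0 t₂, ∀ c, HasTrace (∑ k : g, bra (EuclideanSpace.single (i, k) 1) ∘L
      (V t ∘L tensorOp (ρA ⊗ₖ gibbs β HG) ρCl ∘L V (-t)) ∘L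
        ket (EuclideanSpace.single (j, k) 1)) c → D t = c - freeState HA ρA t i j := by
    intro t ht c hc
    rw [hc.unique (htrace t ht i j), ← traceG_exp_conj_kronecker_gibbs HA ρA hHG β t,
      traceG_apply_eq_sum E, Matrix.of_apply, ← Finset.sum_sub_distrib]
    refine Finset.sum_congr rfl fun m _ => ?_
    rw [← Finset.sum_sub_distrib]
    refine Finset.sum_congr rfl fun l _ => ?_
    rw [inner_exp_conj (isHermitian_freeHamiltonian hHA hHG) (he m) (he l), neg_mul]
    ring
  have hana : AnalyticOnNhd ℝ D (Set.Icc 0 t₂) := by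
    intro t ht
    refine Finset.analyticAt_fun_sum _ fun m _ => Finset.analyticAt_fun_sum _ fun l _ => ?_
    exact analyticAt_const.mul ((((analyticAt_cexp_mul _ t).mul (analyticAt_cexp_mul _ t)).mul
      analyticAt_const).mul ((hZ m l t ht).1.sub analyticAt_const))
  -- Up to time `t₁` the dynamics is free, so `D` vanishes there.
  have hlocal : D =ᶠ[nhds (t₁ / 2)] 0 := by
    filter_upwards [Icc_mem_nhds (half_pos ht₁) (half_lt_self ht₁)] with t ht
    rw [hD t ⟨ht.1, ht.2.trans ht₂.le⟩ _ (hfree t ht i j), sub_self, Pi.zero_apply]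
  have hfinal := hana.eqOn_zero_of_preconnected_of_eventuallyEq_zero isPreconnected_Icc
    (z₀ := t₁ / 2) ⟨by linarith, by linarith⟩ hlocal (x := t₂) ⟨by linarith, le_rfl⟩
  rw [hD t₂ ⟨by linarith, le_rfl⟩ _ (htherm t₂ ⟨le_rfl, ht₃.le⟩ i j)] at hfinal
  exact sub_eq_zero.1 hfinal

end Dynamics

end IdealisedControl

open IdealisedControl in
theorem proposition2 {a g ι 𝓗 : Type*}
    [Fintype a] [DecidableEq a] [Fintype g] [DecidableEq g] [Fintype ι]
    [NormedAddCommGroup 𝓗] [InnerProductSpace ℂ 𝓗] [CompleteSpace 𝓗]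
    (HA : Matrix a a ℂ) (hHA : HA.IsHermitian) (HG : Matrix g g ℂ) (hHG : HG.IsHermitian) (β : ℝ)
    (H : Tensor (a × g) 𝓗 →ₗ.[ℂ] Tensor (a × g) 𝓗) (hH : IsSelfAdjoint H)
    (E : OrthonormalBasis ι ℂ (EuclideanSpace ℂ (a × g)))
    (hE : ∀ l, ∃ e : ℝ, Matrix.toEuclideanLin (freeHamiltonian HA HG) (E l) = (e : ℂ) • E l)
    (ρCl : 𝓗 →L[ℂ] 𝓗) (hρCl : IsDensityOperator ρCl)
    (t₁ t₂ t₃ : ℝ) (ht₁ : 0 < t₁) (ht₂ : t₁ < t₂) (ht₃ : t₂ < t₃) :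
    (∀ ρA : Matrix a a ℂ, IsDensityMatrix ρA →
      ¬ (ExpansionsConverge H (freeHamiltonian HA HG) E ρCl t₂ ∧
          ∃ U : Matrix (a × g) (a × g) ℂ,
            IsNondegenerateEnergyPreserving U (freeHamiltonian HA HG) H E ∧
            Implements HA H U (gibbs β HG) ρCl t₁ t₂ t₃ ρA ∧
            ∃ t ∈ Set.Icc t₂ t₃,
              thermalOp U (gibbs β HG) (freeState HA ρA t) ≠ freeState HA ρA t)) ∧
    (2 ≤ Fintype.card a →
      ¬ (ExpansionsConverge H (freeHamiltonian HA HG) E ρCl t₂ ∧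
          ∃ U : Matrix (a × g) (a × g) ℂ,
            IsNondegenerateEnergyPreserving U (freeHamiltonian HA HG) H E ∧
            ∀ ρA : Matrix a a ℂ, IsDensityMatrix ρA →
              Implements HA H U (gibbs β HG) ρCl t₁ t₂ t₃ ρA)) := by
  refine ⟨?_, ?_⟩
  · rintro ρA hρA ⟨hexp, U, hU, himp, t, -, hne⟩
    have h := (thermalOp_eq_freeState_of_implements hHA hHG hH hE hρCl ht₁ ht₂ ht₃ hexp hU hρA
      himp).2
    exact hne (thermalOp_fixed_of_fixed hHA hHG β hU.commute_free ρA h t)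
  · rintro ha ⟨hexp, U, hU, himp⟩
    have h := fun ρA (hρA : IsDensityMatrix ρA) =>
      thermalOp_eq_freeState_of_implements hHA hHG hH hE hρCl ht₁ ht₂ ht₃ hexp hU hρA (himp ρA hρA)
    have : Nontrivial a := Fintype.one_lt_card_iff_nontrivial.1 ha
    obtain ⟨i⟩ := (inferInstance : Nonempty a)
    -- Applying `h` to a single state shows that `g` is non-empty.
    have hi : IsDensityMatrix (Matrix.vecMulVec (Pi.single i 1 : a → ℂ) (star (Pi.single i 1))) :=
      ⟨Matrix.posSemidef_vecMulVec_self_star _, by simp [Matrix.trace_vecMulVec]⟩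
    have := (h _ hi).1
    have hfix : ∀ ρ, IsDensityMatrix ρ → thermalOp U (gibbs β HG) ρ = ρ := by
      intro ρ hρ
      have h1 := thermalOp_fixed_of_fixed hHA hHG β hU.commute_free ρ (h ρ hρ).2 0
      rwa [freeState_zero] at h1
    obtain ⟨W, rfl⟩ := exists_eq_one_kronecker (posDef_gibbs hHG β) hfix
    obtain ⟨u, hu, hUE⟩ := hU.spectrum
    exact not_injective_of_eq_one_kronecker ha hUE hu
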